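/- **Setting.** Let $a\in\mathbb R$, $a<b\le\infty$. For $j=0,1$ let $$\tau_j=\frac1{r_j}\Big(-\frac{\mathrm d}{\mathrm dx}\,p_j\,\frac{\mathrm d}{\mathrm dx}+q_j\Big)\quad\text{on }(a,b),$$ where $p_j,q_j,r_j$ are real-valued functions, $p_j,r_j>0$ almost everywhere, $1/p_j,q_j,r_j\in L^1_{\mathrm{loc}}(a,b)$, and $\tau_j$ is regular at $a$, i.e. $1/p_j,q_j,r_j$ are integrable near $a$. A solution of $(\tau_j-\lambda)u=0$ is a function $u$ such that $u$ and $p_ju'$ are locally absolutely continuous and the equation holds almost everywhere. The expression $\tau_j-\lambda$ is called nonoscillatory if there is a nontrivial real-valued solution of $(\tau_j-\lambda)u=0$ with at most finitely many zeros in $(a,b)$, and oscillatory otherwise. Let $\lambda\in\mathbb R$ (for instance, the minimum of the spectrum of a self-adjoint realization $T_0$ of $\tau_0$ in $L^2((a,b);r_0)$ that is bounded from below). Suppose that $(\tau_0-\lambda)u=0$ has a minimal positive solution $u_0$ near $b$, i.e. a solution $u_0$ that is positive on $(d,b)$ for some $d\in[a,b)$ and satisfies $\int_c^b \frac{dt}{p_0(t)u_0(t)^2}=\infty$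 for $c\in(d,b)$. Fix $c\in(d,b)$ and put $$v_0(x):=u_0(x)\int_c^x\frac{dt}{p_0(t)u_0(t)^2},\qquad \rho(x):=\frac1{p_0(x)u_0(x)v_0(x)},$$ $$\Delta(x):=p_0(x)v_0(x)^2\Big(u_0(x)^2\big(q_1(x)-q_0(x)-\lambda(r_1(x)-r_0(x))\big)+\big(p_0(x)u_0'(x)\big)^2\,\frac{p_1(x)-p_0(x)}{p_1(x)p_0(x)}\Big).$$ The conditions below that involve the values of functions determined only almost everywhere (limits, boundedness and $o(\cdot)$ as $x\to b$) are understood up to null sets. Suppose that $$\lim_{x\to b}v_0(x)\,p_0(x)u_0'(x)\,\frac{p_1(x)-p_0(x)}{p_1(x)}=\lim_{x\to b}\frac{p_1(x)-p_0(x)}{p_1(x)}=0 .$$ **Theorem.** Suppose, in addition, that $\Delta$ and $\rho$ are bounded near $b$, that $\rho(x)=o(1)$ as $x\to b$, and that for some $\ell>0$ $$\frac1\ell\int_0^\ell|\rho(x+t)-\rho(x)|\,dt=o(\rho(x))\qquad(x\to b).$$ (Boundedness of $\rho$ near $b$ forces $b=\infty$, and the last condition for one $\ell>0$ is equivalent to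 the condition for all $\ell>0$.) Then $\tau_1-\lambda$ is oscillatory if $$\inf_{\ell>0}\ \limsup_{x\to b}\ \frac1\ell\int_x^{x+\ell}\Delta(t)\,dt<-\frac14,$$ and $\tau_1-\lambda$ is nonoscillatory if $$\sup_{\ell>0}\ \liminf_{x\to b}\ \frac1\ell\int_x^{x+\ell}\Delta(t)\,dt>-\frac14 .$$ -/

import Mathlib

open Filter Topology MeasureTheory Asymptotics

/-- Coefficients of a Sturm-Liouville differential expression `τ = (1/r) (-(d/dx) p (d/dx) + q)`. -/
structure SLExpr where
  p : ℝ → ℝ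
  q : ℝ → ℝ
  r : ℝ → ℝ

/-- The open interval `(a, b)` with finite left endpoint and `b ≤ ∞`. -/
def openIval (a : ℝ) (b : EReal) : Set ℝ := {x | a < x ∧ (x : EReal) < b}

/-- The filter `x → b` from the left, on the real line, where `b = ∞` is allowed. -/
noncomputable def leftNhds (b : EReal) : Filter ℝ := comap (fun x : ℝ => (x : EReal)) (𝓝[<] b)

/-- The filter `x → b` from the left, up to Lebesgue null sets: a limit along it is an essential
limit. The coefficients and derivatives of solutions are only determined almost everywhere. -/
noncomputable def leftNhdsAE (b : EReal) : Filter ℝ := leftNhds b ⊓ ae volume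

/-- `u` is locally absolutely continuous on `(a, b)`. -/
def LocAC (a : ℝ) (b : EReal) (u : ℝ → ℝ) : Prop :=
  ∀ c ∈ openIval a b, ∀ d ∈ openIval a b, AbsolutelyContinuousOnInterval u c d

namespace SLExpr

/-- The standing assumptions on a differential expression on `(a, b)`: `p, r > 0` almost everywhere,
`1/p, q, r` locally integrable on `(a, b)`, and `τ` regular at `a`, that is, `1/p, q, r` are
integrable near `a`. -/
structure IsAdmissible (τ : SLExpr) (a : ℝ) (b : EReal) : Prop where
  p_pos : ∀ᵐ x ∂volume.restrict (openIval a b), 0 < τ.p x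
  r_pos : ∀ᵐ x ∂volume.restrict (openIval a b), 0 < τ.r x
  p_loc : LocallyIntegrableOn (fun x => 1 / τ.p x) (openIval a b)
  q_loc : LocallyIntegrableOn τ.q (openIval a b)
  r_loc : LocallyIntegrableOn τ.r (openIval a b)
  regular : ∃ d ∈ openIval a b, IntegrableOn (fun x => 1 / τ.p x) (Set.Ioo a d) ∧
    IntegrableOn τ.q (Set.Ioo a d) ∧ IntegrableOn τ.r (Set.Ioo a d)

/-- `u` is a real-valued solution of `(τ - lam) u = 0` on `(a, b)`: `u` and the quasi-derivative
`p u'` (more precisely, a representative `w` of it) are locally absolutely continuous, and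
`(1/r) (-(p u')' + q u) = lam u` almost everywhere. -/
def IsSolution (τ : SLExpr) (lam a : ℝ) (b : EReal) (u : ℝ → ℝ) : Prop :=
  LocAC a b u ∧ ∃ w : ℝ → ℝ, LocAC a b w ∧
    (∀ᵐ x ∂volume.restrict (openIval a b), w x = τ.p x * deriv u x) ∧
    (∀ᵐ x ∂volume.restrict (openIval a b),
      1 / τ.r x * (-(deriv w x) + τ.q x * u x) = lam * u x)

/-- `τ - lam` is nonoscillatory on `(a, b)`: some nontrivial real-valued solution has at most
finitely many zeros in `(a, b)`. -/
def IsNonoscillatory (τ : SLExpr) (lam a : ℝ) (b : EReal) : Prop :=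
  ∃ u : ℝ → ℝ, τ.IsSolution lam a b u ∧ (∃ x ∈ openIval a b, u x ≠ 0) ∧
    {x | x ∈ openIval a b ∧ u x = 0}.Finite

/-- `τ - lam` is oscillatory on `(a, b)`. -/
def IsOscillatory (τ : SLExpr) (lam a : ℝ) (b : EReal) : Prop :=
  ¬ τ.IsNonoscillatory lam a b

/-- `u` is a minimal (principal) positive solution of `(τ - lam) u = 0` near `b`, namely on
`(d, b)`: for `c ∈ (d, b)` the integral of `1 / (p u ^ 2)` over `(c, b)` is infinite. -/
structure IsMinimalPositive (τ : SLExpr) (lam d : ℝ) (b : EReal) (u : ℝ → ℝ) : Prop where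
  sol : τ.IsSolution lam d b u
  pos : ∀ x ∈ openIval d b, 0 < u x
  minimal : ∀ c ∈ openIval d b,
    Tendsto (fun x => ∫ t in c..x, 1 / (τ.p t * u t ^ 2)) (leftNhds b) atTop

/-- The second solution given by d'Alembert's formula with base point `c`. -/
noncomputable def dAlembert (τ : SLExpr) (u : ℝ → ℝ) (c x : ℝ) : ℝ :=
  u x * ∫ t in c..x, 1 / (τ.p t * u t ^ 2)

/-- The function `Δ`. -/
noncomputable def Delta (τ₀ τ₁ : SLExpr) (lam : ℝ) (u₀ v₀ : ℝ → ℝ) (x : ℝ) : ℝ :=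
  τ₀.p x * v₀ x ^ 2 *
    (u₀ x ^ 2 * (τ₁.q x - τ₀.q x - lam * (τ₁.r x - τ₀.r x)) +
      (τ₀.p x * deriv u₀ x) ^ 2 * ((τ₁.p x - τ₀.p x) / (τ₁.p x * τ₀.p x)))

/-- The function `ρ = (p₀ u₀ v₀)⁻¹`. -/
noncomputable def rho (τ₀ : SLExpr) (u₀ v₀ : ℝ → ℝ) (x : ℝ) : ℝ :=
  (τ₀.p x * u₀ x * v₀ x)⁻¹

end SLExpr

/-!
The proof is a variation of constants around the minimal solution `u₀`, followed by averaging of a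
Riccati equation. Let `I(x) = ∫_c^x 1 / (p₀ u₀²)`, so that `v₀ = u₀ I` and `ρ = I' / I` is the
derivative of `log I`, which tends to infinity because `u₀` is minimal. In particular a bounded `ρ`
forces `b = ∞`. For a solution `u` of the perturbed equation with quasi-derivative `w`, the unknowns
`y = u / u₀` and `z = I (u₀ w - w₀ u)`, where `w₀ = p₀ u₀'`, satisfy
`y' = ρ ((1 - β) z - α y)` and `z' = ρ ((1 + α) z + Δ y)`, where `α` and `β` are the two functions
assumed to tend to zero (`SLExpr.transformed_system`). Hence `m = z / y` solves
`m' = ρ (Δ + (1 + 2 α) m - (1 - β) m²)`, a perturbation of `m' = ρ (Δ + 1/4 - (m - 1/2)²)`.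

The coefficient `Δ` may be replaced by its average over windows of length `ℓ`. The difference `D`
between the moving average of a primitive of `ρ Δ` and that primitive tends to zero since `ρ` does,
and its derivative is the moving average of `ρ Δ` minus `ρ Δ`. The mean oscillation condition makes
`ρ` slowly varying off a null set over every bounded distance (`slow_variation`), so the moving
average of `ρ Δ` is `ρ` times that of `Δ`, up to `o(ρ)`; see `exists_corrector`.

If the averages stay below `-1/4 - ε`, then `arctan (m + D)` decreases at least at a fixed multiple
of the rate `ρ`, which is impossible on a half-line as `log I` is unbounded
(`no_global_riccati_solution`); so every solution `u` has zeros arbitrarily far out. If the averages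
stay above `-1/4 + ε`, then in the unknowns `y` and `z - (1/2 - D) y` the system has nonnegative
coefficients near infinity, so a solution that starts in the positive quadrant stays there
(`exists_forall_ge_pos`). Such a solution exists by a Carathéodory existence theorem for linear
systems with locally integrable coefficients (`exists_linear_system_solution`), and its remaining
zeros are finitely many because a solution with a double zero vanishes
(`linear_system_zeros_finite`).
-/

/-! ### Local absolute continuity with a given derivative -/

/-- `f` is locally absolutely continuous on `s`, with derivative `f'` almost everywhere on `s`. -/
structure HasACDerivOn (f f' : ℝ → ℝ) (s : Set ℝ) : Prop where
  ac : ∀ x ∈ s, ∀ y ∈ s, AbsolutelyContinuousOnInterval f x y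
  hasDerivAt : ∀ᵐ x, x ∈ s → HasDerivAt f (f' x) x

/-- A property holds almost everywhere on an open set if it does so on each compact interval with
endpoints in the set; rational endpoints suffice. -/
theorem ae_mem_imp_of_forall_Icc {s : Set ℝ} (hs : IsOpen s) {P : ℝ → Prop}
    (h : ∀ q ∈ s, ∀ r ∈ s, ∀ᵐ x, x ∈ Set.Icc q r → P x) : ∀ᵐ x, x ∈ s → P x := by
  have H : ∀ᵐ x, ∀ q r : ℚ, (q : ℝ) ∈ s → (r : ℝ) ∈ s → x ∈ Set.Icc (q : ℝ) r → P x := by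
    refine ae_all_iff.2 fun q => ae_all_iff.2 fun r => ?_
    by_cases hq : (q : ℝ) ∈ s
    · by_cases hr : (r : ℝ) ∈ s
      · filter_upwards [h q hq r hr] with x hx _ _ using hx
      · exact Eventually.of_forall fun x _ h => absurd h hr
    · exact Eventually.of_forall fun x h => absurd h hq
  filter_upwards [H] with x hx hxs
  obtain ⟨ε, hε, hball⟩ := Metric.isOpen_iff.1 hs x hxs
  obtain ⟨q, hq1, hq2⟩ := exists_rat_btwn (show x - ε < x by linarith)
  obtain ⟨r, hr1, hr2⟩ := exists_rat_btwn (show x < x + ε by linarith)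
  refine hx q r (hball ?_) (hball ?_) ⟨hq2.le, hr1.le⟩ <;>
    rw [Metric.mem_ball, Real.dist_eq, abs_lt] <;> constructor <;> linarith

namespace HasACDerivOn

variable {f f' g g' : ℝ → ℝ} {s : Set ℝ}

theorem of_locAC {a : ℝ} {b : EReal} (hf : LocAC a b f)
    (h : ∀ᵐ x, x ∈ openIval a b → deriv f x = f' x) (ho : IsOpen (openIval a b)) :
    HasACDerivOn f f' (openIval a b) where
  ac := hf
  hasDerivAt := by
    refine ae_mem_imp_of_forall_Icc ho fun q hq r hr => ?_
    filter_upwards [(hf q hq r hr).ae_differentiableAt, h] with x hx hx' hxm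
    by_cases hxs : x ∈ openIval a b
    · rw [← hx' hxs]
      exact (hx (Set.Icc_subset_uIcc hxm)).hasDerivAt
    · exact absurd ⟨hq.1.trans_le hxm.1, lt_of_le_of_lt (EReal.coe_le_coe_iff.2 hxm.2) hr.2⟩ hxs

theorem mono (hf : HasACDerivOn f f' s) {t : Set ℝ} (h : t ⊆ s) : HasACDerivOn f f' t :=
  ⟨fun x hx y hy => hf.ac x (h hx) y (h hy), hf.hasDerivAt.mono fun _ hx hxt => hx (h hxt)⟩

theorem congr_deriv (hf : HasACDerivOn f f' s) (h : ∀ᵐ x, x ∈ s → f' x = g' x) :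
    HasACDerivOn f g' s :=
  ⟨hf.ac, by filter_upwards [hf.hasDerivAt, h] with x h1 h2 hx using h2 hx ▸ h1 hx⟩

theorem const (k : ℝ) : HasACDerivOn (fun _ => k) (fun _ => 0) s :=
  ⟨fun _ _ _ _ => (LipschitzWith.const k).lipschitzOnWith.absolutelyContinuousOnInterval,
    Eventually.of_forall fun x _ => hasDerivAt_const x k⟩

theorem id : HasACDerivOn (fun x => x) (fun _ => 1) s :=
  ⟨fun _ _ _ _ => LipschitzWith.id.lipschitzOnWith.absolutelyContinuousOnInterval,
    Eventually.of_forall fun x _ => hasDerivAt_id x⟩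

theorem add (hf : HasACDerivOn f f' s) (hg : HasACDerivOn g g' s) :
    HasACDerivOn (fun x => f x + g x) (fun x => f' x + g' x) s :=
  ⟨fun x hx y hy => (hf.ac x hx y hy).add (hg.ac x hx y hy), by
    filter_upwards [hf.hasDerivAt, hg.hasDerivAt] with x h1 h2 hx using (h1 hx).add (h2 hx)⟩

theorem sub (hf : HasACDerivOn f f' s) (hg : HasACDerivOn g g' s) :
    HasACDerivOn (fun x => f x - g x) (fun x => f' x - g' x) s :=
  ⟨fun x hx y hy => (hf.ac x hx y hy).sub (hg.ac x hx y hy), by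
    filter_upwards [hf.hasDerivAt, hg.hasDerivAt] with x h1 h2 hx using (h1 hx).sub (h2 hx)⟩

theorem mul (hf : HasACDerivOn f f' s) (hg : HasACDerivOn g g' s) :
    HasACDerivOn (fun x => f x * g x) (fun x => f' x * g x + f x * g' x) s :=
  ⟨fun x hx y hy => (hf.ac x hx y hy).mul (hg.ac x hx y hy), by
    filter_upwards [hf.hasDerivAt, hg.hasDerivAt] with x h1 h2 hx using (h1 hx).mul (h2 hx)⟩

theorem const_mul (k : ℝ) (hf : HasACDerivOn f f' s) :
    HasACDerivOn (fun x => k * f x) (fun x => k * f' x) s :=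
  ⟨fun x hx y hy => (hf.ac x hx y hy).const_mul k, by
    filter_upwards [hf.hasDerivAt] with x h1 hx using (h1 hx).const_mul k⟩

theorem neg (hf : HasACDerivOn f f' s) : HasACDerivOn (fun x => -f x) (fun x => -f' x) s :=
  ⟨fun x hx y hy => (hf.ac x hx y hy).neg, by
    filter_upwards [hf.hasDerivAt] with x h1 hx using (h1 hx).neg⟩

/-- The image of a compact interval under `f` is a compact interval, on which a `C¹` function is
Lipschitz; hence the composite is absolutely continuous. -/
theorem comp (hs : s.OrdConnected) {F F' : ℝ → ℝ} {t : Set ℝ}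
    (hF : ContDiffOn ℝ 1 F t) (hF' : ∀ y ∈ t, HasDerivAt F (F' y) y)
    (hf : HasACDerivOn f f' s) (hft : Set.MapsTo f s t) :
    HasACDerivOn (fun x => F (f x)) (fun x => F' (f x) * f' x) s := by
  refine ⟨fun x hx y hy => ?_, ?_⟩
  · have hsub : Set.uIcc x y ⊆ s := hs.uIcc_subset hx hy
    have hac := hf.ac x hx y hy
    have hK : IsCompact (f '' Set.uIcc x y) := isCompact_uIcc.image_of_continuousOn hac.continuousOn
    have hC : Convex ℝ (f '' Set.uIcc x y) :=
      ((isPreconnected_uIcc.image _ hac.continuousOn).ordConnected).convex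
    have hst : f '' Set.uIcc x y ⊆ t := by
      rintro _ ⟨v, hv, rfl⟩
      exact hft (hsub hv)
    obtain ⟨K, hLip⟩ := (hF.mono hst).exists_lipschitzOnWith one_ne_zero hC hK
    refine squeeze_zero' (Eventually.of_forall fun E => Finset.sum_nonneg fun i _ => dist_nonneg) ?_
      (by simpa using Tendsto.const_mul (K : ℝ) hac)
    refine (eventually_inf_principal.2 (Eventually.of_forall fun E hE => ?_))
    rw [Finset.mul_sum]
    refine Finset.sum_le_sum fun i hi => ?_
    exact hLip.dist_le_mul _ ⟨_, (hE.1 i hi).1, rfl⟩ _ ⟨_, (hE.1 i hi).2, rfl⟩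
  · filter_upwards [hf.hasDerivAt] with x h1 hx
    exact (hF' _ (hft hx)).comp x (h1 hx)

theorem inv (hs : s.OrdConnected) (hf : HasACDerivOn f f' s) (h0 : ∀ x ∈ s, f x ≠ 0) :
    HasACDerivOn (fun x => (f x)⁻¹) (fun x => -(f x ^ 2)⁻¹ * f' x) s :=
  comp hs (F := fun y => y⁻¹) (F' := fun y => -(y ^ 2)⁻¹)
    (t := {0}ᶜ) (contDiffOn_inv ℝ) (fun _ hy => hasDerivAt_inv hy) hf h0

theorem log (hs : s.OrdConnected) (hf : HasACDerivOn f f' s) (h0 : ∀ x ∈ s, f x ≠ 0) :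
    HasACDerivOn (fun x => Real.log (f x)) (fun x => (f x)⁻¹ * f' x) s :=
  comp hs (F' := fun y => y⁻¹) (t := {0}ᶜ) Real.contDiffOn_log
    (fun _ hy => Real.hasDerivAt_log hy) hf h0

theorem arctan (hs : s.OrdConnected) (hf : HasACDerivOn f f' s) :
    HasACDerivOn (fun x => Real.arctan (f x)) (fun x => 1 / (1 + f x ^ 2) * f' x) s :=
  comp (t := Set.univ) hs Real.contDiff_arctan.contDiffOn
    (fun y _ => Real.hasDerivAt_arctan y) hf fun _ _ => trivial

theorem exp (hs : s.OrdConnected) (hf : HasACDerivOn f f' s) :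
    HasACDerivOn (fun x => Real.exp (f x)) (fun x => Real.exp (f x) * f' x) s :=
  comp (t := Set.univ) hs Real.contDiff_exp.contDiffOn
    (fun y _ => Real.hasDerivAt_exp y) hf fun _ _ => trivial

theorem continuousOn (ho : IsOpen s) (hf : HasACDerivOn f f' s) :
    ContinuousOn f s := by
  intro x hx
  obtain ⟨ε, hε, hball⟩ := Metric.isOpen_iff.1 ho x hx
  have h1 : x - ε / 2 ∈ s := hball (by
    rw [Metric.mem_ball, Real.dist_eq, abs_lt]; constructor <;> linarith)
  have h2 : x + ε / 2 ∈ s := hball (by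
    rw [Metric.mem_ball, Real.dist_eq, abs_lt]; constructor <;> linarith)
  refine ((hf.ac _ h1 _ h2).continuousOn.continuousAt ?_).continuousWithinAt
  rw [Set.uIcc_of_le (by linarith)]
  exact Icc_mem_nhds (by linarith) (by linarith)

theorem deriv_ae_eq (hs : s.OrdConnected) (hf : HasACDerivOn f f' s) {x y : ℝ} (hx : x ∈ s)
    (hy : y ∈ s) : ∀ᵐ t, t ∈ Set.uIoc x y → deriv f t = f' t := by
  filter_upwards [hf.hasDerivAt] with t ht hts
  exact (ht (hs.uIcc_subset hx hy (Set.uIoc_subset_uIcc hts))).deriv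

theorem intervalIntegrable (hs : s.OrdConnected) (hf : HasACDerivOn f f' s) {x y : ℝ} (hx : x ∈ s)
    (hy : y ∈ s) : IntervalIntegrable f' volume x y := by
  refine (hf.ac x hx y hy).intervalIntegrable_deriv.congr_ae ?_
  exact (ae_restrict_iff' measurableSet_uIoc).2 (hf.deriv_ae_eq hs hx hy)

theorem integral_eq_sub (hs : s.OrdConnected) (hf : HasACDerivOn f f' s) {x y : ℝ} (hx : x ∈ s)
    (hy : y ∈ s) : ∫ t in x..y, f' t = f y - f x := by
  rw [← (hf.ac x hx y hy).integral_deriv_eq_sub]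
  refine intervalIntegral.integral_congr_ae ?_
  filter_upwards [hf.deriv_ae_eq hs hx hy] with t h1 h2 using (h1 h2).symm

theorem le_of_deriv_nonneg (hs : s.OrdConnected) (hf : HasACDerivOn f f' s) {x y : ℝ} (hx : x ∈ s)
    (hy : y ∈ s) (hxy : x ≤ y) (h : ∀ᵐ t, t ∈ Set.Ioc x y → 0 ≤ f' t) : f x ≤ f y := by
  have := hf.integral_eq_sub hs hx hy
  have h2 : 0 ≤ ∫ t in x..y, f' t := by
    rw [intervalIntegral.integral_of_le hxy]
    exact setIntegral_nonneg_of_ae_restrict ((ae_restrict_iff' measurableSet_Ioc).2 h)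
  linarith

theorem lt_of_deriv_pos (hs : s.OrdConnected) (hf : HasACDerivOn f f' s) {x y : ℝ} (hx : x ∈ s)
    (hy : y ∈ s) (hxy : x < y) (h : ∀ᵐ t, t ∈ Set.Ioc x y → 0 < f' t) : f x < f y := by
  rw [← sub_pos, ← hf.integral_eq_sub hs hx hy,
    intervalIntegral.integral_pos_iff_support_of_nonneg_ae' _ (hf.intervalIntegrable hs hx hy)]
  · refine ⟨hxy, ?_⟩
    have h4 : Set.Ioc x y ≤ᵐ[volume] (Function.support f' ∩ Set.Ioc x y : Set ℝ) := by
      filter_upwards [h] with t ht htm using ⟨(ht htm).ne', htm⟩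
    refine lt_of_lt_of_le ?_ (measure_mono_ae h4)
    simp [hxy]
  · rw [Set.uIoc_of_le hxy.le]
    refine (ae_restrict_iff' measurableSet_Ioc).2 ?_
    filter_upwards [h] with t ht htm using (ht htm).le

/-- The fundamental theorem of calculus for locally integrable functions. -/
theorem integral (hs : s.OrdConnected) (ho : IsOpen s)
    (hf : ∀ x ∈ s, ∀ y ∈ s, IntervalIntegrable f' volume x y) {c : ℝ} (hc : c ∈ s) :
    HasACDerivOn (fun x => ∫ t in c..x, f' t) f' s := by
  have key : ∀ q ∈ s, ∀ x ∈ s, (∫ t in c..x, f' t) = (∫ t in c..q, f' t) + ∫ t in q..x, f' t :=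
    fun q hq x hx => (intervalIntegral.integral_add_adjacent_intervals (hf c hc q hq)
      (hf q hq x hx)).symm
  refine ⟨fun x hx y hy => ?_, ae_mem_imp_of_forall_Icc ho fun q hq r hr => ?_⟩
  · have h1 : min c (min x y) ∈ s := by
      rcases min_choice c (min x y) with h | h <;> rw [h]
      · exact hc
      · rcases min_choice x y with h | h <;> rw [h] <;> assumption
    have h2 : max c (max x y) ∈ s := by
      rcases max_choice c (max x y) with h | h <;> rw [h]
      · exact hc
      · rcases max_choice x y with h | h <;> rw [h] <;> assumption
    refine ((hf _ h1 _ h2).absolutelyContinuousOnInterval_intervalIntegral (c := c) ?_).mono ?_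
    · exact Set.Icc_subset_uIcc ⟨by simp, by simp⟩
    · refine Set.uIcc_subset_uIcc (Set.Icc_subset_uIcc ?_) (Set.Icc_subset_uIcc ?_) <;>
        constructor <;> simp
  · filter_upwards [(hf q hq r hr).ae_hasDerivAt_integral] with x hx hxm
    have hxs : x ∈ s := hs.out hq hr hxm
    have h := (hx (Set.Icc_subset_uIcc hxm) q Set.left_mem_uIcc).const_add (∫ t in c..q, f' t)
    refine h.congr_of_eventuallyEq ?_
    filter_upwards [ho.mem_nhds hxs] with v hv using key q hq v hv

end HasACDerivOn

/-! ### Essential limits at infinity -/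

theorem leftNhds_top : leftNhds ⊤ = atTop := by
  have h : 𝓝[<] (⊤ : EReal) = map Real.toEReal atTop := by
    rw [← EReal.nhdsWithin_top]
    congr 1
    ext x
    simp [lt_top_iff_ne_top]
  rw [leftNhds, h, comap_map EReal.coe_injective]

theorem eventually_leftNhdsAE_top {P : ℝ → Prop} :
    (∀ᶠ x in leftNhdsAE ⊤, P x) ↔ ∃ X, ∀ᵐ x, X < x → P x := by
  rw [leftNhdsAE, leftNhds_top]
  constructor
  · intro h
    obtain ⟨A, hA, B, hB, hAB⟩ := mem_inf_iff_superset.1 h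
    obtain ⟨X, hX⟩ := mem_atTop_sets.1 hA
    refine ⟨X, ?_⟩
    filter_upwards [hB] with x hx hxX using hAB ⟨hX x hxX.le, hx⟩
  · rintro ⟨X, hX⟩
    exact mem_inf_iff_superset.2 ⟨_, Ioi_mem_atTop X, _, hX, fun x hx => hx.2 hx.1⟩

theorem exists_mem_Ioo_of_mem_ae {S : Set ℝ} (hS : S ∈ ae (volume : Measure ℝ)) {x y : ℝ}
    (hxy : x < y) : ∃ z ∈ S, z ∈ Set.Ioo x y := by
  by_contra! h
  have h1 : Set.Ioo x y ⊆ Sᶜ := fun z hz hzS => h z hzS hz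
  have h2 : volume (Set.Ioo x y) = 0 := measure_mono_null h1 (mem_ae_iff.1 hS)
  rw [Real.volume_Ioo, ENNReal.ofReal_eq_zero] at h2
  linarith

/-! ### Slow variation and moving averages -/

/-- If the mean oscillation of `ρ` over windows of length `ℓ` is `o(ρ)`, then `ρ` varies slowly
over short distances: two windows starting at most `ℓ / 2` apart overlap in a set of measure at
least `ℓ / 2`, on which `ρ` is on average close to both starting values. -/
theorem slow_variation_half_window {ρ : ℝ → ℝ} {X : ℝ}
    (hint : ∀ x ∈ Set.Ioi X, ∀ y ∈ Set.Ioi X, IntervalIntegrable ρ volume x y)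
    (hpos : ∀ᵐ x, X < x → 0 < ρ x) {ℓ : ℝ} (hℓ : 0 < ℓ)
    (hosc : ∀ ε > 0, ∃ Y, ∀ᵐ x, Y < x → ∫ t in (0 : ℝ)..ℓ, |ρ (x + t) - ρ x| ≤ ε * ρ x)
    {ε : ℝ} (hε : 0 < ε) :
    ∃ Y, ∃ S ∈ ae (volume : Measure ℝ), ∀ x ∈ S, ∀ y ∈ S, Y < x → x ≤ y → y ≤ x + ℓ / 2 →
      |ρ y - ρ x| ≤ ε * ρ x := by
  set η := min (ε / 4) (1 / 2) with hη
  have hη0 : 0 < η := by positivity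
  have hη1 : 4 * η ≤ ε := by linarith [min_le_left (ε / 4) (1 / 2 : ℝ)]
  have hη2 : η ≤ 1 / 2 := min_le_right _ _
  obtain ⟨Y, hY⟩ := hosc (η * (ℓ / 2)) (by positivity)
  refine ⟨max X Y, _, inter_mem hY hpos, ?_⟩
  rintro x ⟨hx1, hx2⟩ y ⟨hy1, hy2⟩ hYx hxy hyx
  have hXx : X < x := (le_max_left _ _).trans_lt hYx
  have hρx := hx2 hXx
  have hρy := hy2 (hXx.trans_le hxy)
  have hA := hx1 ((le_max_right _ _).trans_lt hYx)
  have hB := hy1 (((le_max_right _ _).trans_lt hYx).trans_le hxy)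
  have int : ∀ k : ℝ, ∀ u ∈ Set.Ioi X, ∀ v ∈ Set.Ioi X,
      IntervalIntegrable (fun t => |ρ t - k|) volume u v :=
    fun k u hu v hv => ((hint u hu v hv).sub intervalIntegrable_const).abs
  have hshift : ∀ v : ℝ, (∫ t in (0 : ℝ)..ℓ, |ρ (v + t) - ρ v|) = ∫ t in v..v + ℓ, |ρ t - ρ v| := by
    intro v
    rw [intervalIntegral.integral_comp_add_left (fun t => |ρ t - ρ v|)]
    simp
  rw [hshift] at hA hB
  have hXy : X < y := hXx.trans_le hxy
  have hXl : X < x + ℓ := by linarith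
  -- On the overlap `(y, x + ℓ)` of the two windows, `ρ` is close to both `ρ x` and `ρ y`.
  have hA' : ∫ t in y..x + ℓ, |ρ t - ρ x| ≤ ∫ t in x..x + ℓ, |ρ t - ρ x| :=
    intervalIntegral.integral_mono_interval hxy (by linarith) le_rfl
      (Eventually.of_forall fun t => abs_nonneg _) (int _ _ hXx _ hXl)
  have hB' : ∫ t in y..x + ℓ, |ρ t - ρ y| ≤ ∫ t in y..y + ℓ, |ρ t - ρ y| :=
    intervalIntegral.integral_mono_interval le_rfl (by linarith) (by linarith)
      (Eventually.of_forall fun t => abs_nonneg _) (int _ _ hXy _ (by simp; linarith))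
  have hC : ∫ t in y..x + ℓ, |ρ y - ρ x| ≤
      ∫ t in y..x + ℓ, (|ρ t - ρ x| + |ρ t - ρ y|) := by
    refine intervalIntegral.integral_mono_on (by linarith) intervalIntegrable_const
      ((int _ _ hXy _ hXl).add (int _ _ hXy _ hXl)) fun t _ => ?_
    rw [abs_sub_comm (ρ t) (ρ y), add_comm]
    exact abs_sub_le _ _ _
  rw [intervalIntegral.integral_add (int _ _ hXy _ hXl) (int _ _ hXy _ hXl),
    intervalIntegral.integral_const, smul_eq_mul] at hC
  have hD : ℓ / 2 * |ρ y - ρ x| ≤ (x + ℓ - y) * |ρ y - ρ x| :=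
    mul_le_mul_of_nonneg_right (by linarith) (abs_nonneg _)
  have hE : |ρ y - ρ x| ≤ η * (ρ x + ρ y) := by
    have : ℓ / 2 * |ρ y - ρ x| ≤ ℓ / 2 * (η * (ρ x + ρ y)) := by linarith
    exact le_of_mul_le_mul_left this (by positivity)
  have hF : ρ y ≤ 3 * ρ x := by
    have h1 := (le_abs_self _).trans hE
    have h2 : η * (ρ x + ρ y) ≤ 1 / 2 * (ρ x + ρ y) :=
      mul_le_mul_of_nonneg_right hη2 (by linarith)
    linarith
  calc |ρ y - ρ x| ≤ η * (ρ x + ρ y) := hE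
    _ ≤ η * (4 * ρ x) := mul_le_mul_of_nonneg_left (by linarith) hη0.le
    _ = 4 * η * ρ x := by ring
    _ ≤ ε * ρ x := mul_le_mul_of_nonneg_right hη1 hρx.le

/-- Small mean oscillation over one window length gives slow variation over every bounded
distance, by chaining the short-distance estimate through points off a null set. -/
theorem slow_variation {ρ : ℝ → ℝ} {X : ℝ}
    (hint : ∀ x ∈ Set.Ioi X, ∀ y ∈ Set.Ioi X, IntervalIntegrable ρ volume x y)
    (hpos : ∀ᵐ x, X < x → 0 < ρ x) {ℓ : ℝ} (hℓ : 0 < ℓ)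
    (hosc : ∀ ε > 0, ∃ Y, ∀ᵐ x, Y < x → ∫ t in (0 : ℝ)..ℓ, |ρ (x + t) - ρ x| ≤ ε * ρ x)
    (L : ℝ) {ε : ℝ} (hε : 0 < ε) :
    ∃ Y, ∃ S ∈ ae (volume : Measure ℝ), ∀ x ∈ S, ∀ y ∈ S, Y < x → x ≤ y → y ≤ x + L →
      |ρ y - ρ x| ≤ ε * ρ x := by
  have key : ∀ n : ℕ, ∀ ε > 0, ∃ Y, ∃ S ∈ ae (volume : Measure ℝ), ∀ x ∈ S, ∀ y ∈ S, Y < x →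
      x ≤ y → y ≤ x + (n + 1) * (ℓ / 4) → |ρ y - ρ x| ≤ ε * ρ x := by
    intro n
    induction n with
    | zero =>
      intro ε hε
      obtain ⟨Y, S, hS, h⟩ := slow_variation_half_window hint hpos hℓ hosc hε
      refine ⟨Y, S, hS, fun x hx y hy h1 h2 h3 => h x hx y hy h1 h2 ?_⟩
      simp only [CharP.cast_eq_zero, zero_add, one_mul] at h3
      linarith
    | succ n ih =>
      intro ε hε
      set η := min (ε / 3) 1 with hη
      have hη0 : 0 < η := by positivity
      have hη1 : 3 * η ≤ ε := by linarith [min_le_left (ε / 3) (1 : ℝ)]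
      have hη2 : η ≤ 1 := min_le_right _ _
      obtain ⟨Y₁, S₁, hS₁, h₁⟩ := slow_variation_half_window hint hpos hℓ hosc hη0
      obtain ⟨Y₂, S₂, hS₂, h₂⟩ := ih η hη0
      have hS := inter_mem (inter_mem hS₁ hS₂) hpos
      refine ⟨max X (max Y₁ Y₂), _, hS, ?_⟩
      rintro x ⟨⟨hx1, hx2⟩, hx3⟩ y ⟨⟨hy1, hy2⟩, hy3⟩ hYx hxy hyx
      obtain ⟨hXx, hYx'⟩ := max_lt_iff.1 hYx
      obtain ⟨hY1x, hY2x⟩ := max_lt_iff.1 hYx'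
      have hρx : 0 < ρ x := hx3 hXx
      push_cast at hyx
      by_cases hc : y ≤ x + (n + 1) * (ℓ / 4)
      · exact (h₂ x hx2 y hy2 hY2x hxy hc).trans
          (mul_le_mul_of_nonneg_right (by linarith) hρx.le)
      push Not at hc
      -- The intermediate point is within the distance of the induction hypothesis from `x`, and
      -- within `ℓ / 2` of `y`.
      obtain ⟨z, ⟨⟨hz1, hz2⟩, hz3⟩, hz4, hz5⟩ := exists_mem_Ioo_of_mem_ae hS
        (show x + n * (ℓ / 4) < x + (n + 1) * (ℓ / 4) by nlinarith)
      have hxz : x ≤ z := le_trans (le_add_of_nonneg_right (by positivity)) hz4.le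
      have e1 := h₂ x hx2 z hz2 hY2x hxz hz5.le
      have e2 := h₁ z hz1 y hy1 (by linarith) (by linarith) (by linarith)
      have e3 : ρ z ≤ 2 * ρ x := by
        have := (le_abs_self _).trans e1
        nlinarith
      calc |ρ y - ρ x| ≤ |ρ y - ρ z| + |ρ z - ρ x| := abs_sub_le _ _ _
        _ ≤ η * (2 * ρ x) + η * ρ x :=
          add_le_add (e2.trans (mul_le_mul_of_nonneg_left e3 hη0.le)) e1
        _ = 3 * η * ρ x := by ring
        _ ≤ ε * ρ x := mul_le_mul_of_nonneg_right hη1 hρx.le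
  obtain ⟨n, hn⟩ := exists_nat_ge (L / (ℓ / 4))
  obtain ⟨Y, S, hS, h⟩ := key n ε hε
  refine ⟨Y, S, hS, fun x hx y hy h1 h2 h3 => h x hx y hy h1 h2 (h3.trans ?_)⟩
  rw [div_le_iff₀ (by positivity)] at hn
  linarith

/-- A slowly varying weight `ρ` can be pulled out of window integrals against a bounded function. -/
theorem window_integral_mul_sub_le {ρ Δ : ℝ → ℝ} {X : ℝ}
    (hint : ∀ x ∈ Set.Ioi X, ∀ y ∈ Set.Ioi X, IntervalIntegrable ρ volume x y)
    (hpos : ∀ᵐ x, X < x → 0 < ρ x)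
    (hosc : ∃ ℓ > 0, ∀ ε > 0, ∃ Y, ∀ᵐ x, Y < x →
      ∫ t in (0 : ℝ)..ℓ, |ρ (x + t) - ρ x| ≤ ε * ρ x)
    (hΔint : ∀ x ∈ Set.Ioi X, ∀ y ∈ Set.Ioi X, IntervalIntegrable Δ volume x y)
    (hρΔint : ∀ x ∈ Set.Ioi X, ∀ y ∈ Set.Ioi X,
      IntervalIntegrable (fun t => ρ t * Δ t) volume x y)
    {C : ℝ} (hΔ : ∀ᵐ x, X < x → |Δ x| ≤ C) {ℓ : ℝ} (hℓ : 0 < ℓ) {ε : ℝ} (hε : 0 < ε) :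
    ∃ Y, ∀ᵐ x, Y < x →
      |(∫ t in x..x + ℓ, ρ t * Δ t) - ρ x * ∫ t in x..x + ℓ, Δ t| ≤ ε * ρ x := by
  obtain ⟨ℓ₀, hℓ₀, hosc⟩ := hosc
  set K := (|C| + 1) * ℓ with hK
  have hK0 : 0 < K := by positivity
  obtain ⟨Y, S, hS, h⟩ := slow_variation hint hpos hℓ₀ hosc ℓ (div_pos hε hK0)
  refine ⟨max X Y, ?_⟩
  filter_upwards [hS, hpos] with x hxS hx hxY
  obtain ⟨hXx, hYx⟩ := max_lt_iff.1 hxY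
  have hXl : x + ℓ ∈ Set.Ioi X := by simp; linarith
  rw [← intervalIntegral.integral_const_mul, ← intervalIntegral.integral_sub
    (hρΔint _ hXx _ hXl) ((hΔint _ hXx _ hXl).const_mul _)]
  have hb : ∀ᵐ t, t ∈ Set.uIoc x (x + ℓ) →
      ‖ρ t * Δ t - ρ x * Δ t‖ ≤ ε / K * ρ x * (|C| + 1) := by
    filter_upwards [hS, hΔ] with t ht1 ht2 ht
    rw [Set.uIoc_of_le (by linarith)] at ht
    rw [← sub_mul, Real.norm_eq_abs, abs_mul]
    have := ht2 (lt_trans hXx ht.1)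
    exact mul_le_mul (h x hxS t ht1 hYx ht.1.le ht.2) (by linarith [le_abs_self C])
      (abs_nonneg _) (mul_nonneg (by positivity) (hx hXx).le)
  have := intervalIntegral.norm_integral_le_of_norm_le_const_ae hb
  rw [Real.norm_eq_abs] at this
  refine this.trans (le_of_eq ?_)
  rw [add_sub_cancel_left, abs_of_pos hℓ, hK]
  field_simp

/-- The difference between a primitive of `g` and its moving average. If `g` tends to zero at
infinity off a null set, so does this difference, and its derivative replaces `g` by the moving
average of `g`. -/
theorem exists_average_corrector {g : ℝ → ℝ} {X : ℝ}
    (hint : ∀ x ∈ Set.Ioi X, ∀ y ∈ Set.Ioi X, IntervalIntegrable g volume x y)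
    (hg : ∀ ε > 0, ∃ Y, ∀ᵐ x, Y < x → |g x| ≤ ε) {ℓ : ℝ} (hℓ : 0 < ℓ) :
    ∃ D : ℝ → ℝ, HasACDerivOn D (fun x => 1 / ℓ * (∫ t in x..x + ℓ, g t) - g x) (Set.Ioi X) ∧
      Tendsto D atTop (𝓝 0) := by
  have hs : (Set.Ioi X).OrdConnected := Set.ordConnected_Ioi
  have hc : X + 1 ∈ Set.Ioi X := by simp
  set R : ℝ → ℝ := fun x => ∫ t in (X + 1)..x, g t with hR
  have hRd : HasACDerivOn R g (Set.Ioi X) := HasACDerivOn.integral hs isOpen_Ioi hint hc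
  have hRc := hRd.continuousOn isOpen_Ioi
  have hRint : ∀ x ∈ Set.Ioi X, ∀ y ∈ Set.Ioi X, IntervalIntegrable R volume x y :=
    fun x hx y hy => (hRc.mono (hs.uIcc_subset hx hy)).intervalIntegrable
  have hRsub : ∀ x ∈ Set.Ioi X, ∀ y ∈ Set.Ioi X, R y - R x = ∫ t in x..y, g t :=
    fun x hx y hy => (hRd.integral_eq_sub hs hx hy).symm
  have hshift : ∀ x ∈ Set.Ioi X, x + ℓ ∈ Set.Ioi X := fun x hx => by
    simp only [Set.mem_Ioi] at hx ⊢; linarith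
  set M : ℝ → ℝ := fun x => ∫ t in (X + 1)..x, (R (t + ℓ) - R t) with hM
  have hcont : ContinuousOn (fun t => R (t + ℓ) - R t) (Set.Ioi X) :=
    (hRc.comp (by fun_prop) hshift).sub hRc
  have hMd : HasACDerivOn M (fun t => R (t + ℓ) - R t) (Set.Ioi X) :=
    HasACDerivOn.integral hs isOpen_Ioi
      (fun x hx y hy => (hcont.mono (hs.uIcc_subset hx hy)).intervalIntegrable) hc
  set k : ℝ := ∫ t in (X + 1)..(X + 1 + ℓ), R t with hk
  have hMeq : ∀ x ∈ Set.Ioi X, M x + k = ∫ t in x..x + ℓ, R t := by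
    intro x hx
    have h1 : IntervalIntegrable (fun t => R (t + ℓ)) volume (X + 1) x :=
      ((hRc.comp (by fun_prop) hshift).mono (hs.uIcc_subset hc hx)).intervalIntegrable
    have e1 : M x = (∫ t in (X + 1 + ℓ)..(x + ℓ), R t) - ∫ t in (X + 1)..x, R t := by
      rw [hM]
      simp only
      rw [intervalIntegral.integral_sub h1 (hRint _ hc _ hx),
        intervalIntegral.integral_comp_add_right R]
    have e2 := intervalIntegral.integral_add_adjacent_intervals (hRint _ hc _ (hshift _ hc))
      (hRint _ (hshift _ hc) _ (hshift _ hx))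
    have e3 := intervalIntegral.integral_add_adjacent_intervals (hRint _ hc _ hx)
      (hRint _ hx _ (hshift _ hx))
    linarith
  refine ⟨fun x => 1 / ℓ * (M x + k) - R x, ?_, ?_⟩
  · have h := ((hMd.add (HasACDerivOn.const k)).const_mul (1 / ℓ)).sub hRd
    refine h.congr_deriv (Eventually.of_forall fun x hx => ?_)
    simp only [add_zero]
    rw [hRsub x hx _ (hshift x hx)]
  · rw [Metric.tendsto_atTop]
    intro ε hε
    obtain ⟨Y, hY⟩ := hg (ε / (2 * ℓ)) (by positivity)
    refine ⟨max X Y + 1, fun x hx => ?_⟩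
    have hXx : X < x := by linarith [le_max_left X Y]
    have hYx : Y < x := by linarith [le_max_right X Y]
    have hosc : ∀ t ∈ Set.uIoc x (x + ℓ), ‖R t - R x‖ ≤ ε / 2 := by
      intro t ht
      rw [Set.uIoc_of_le (by linarith)] at ht
      rw [hRsub x hXx t (hXx.trans ht.1)]
      have hb : ∀ᵐ v, v ∈ Set.uIoc x t → ‖g v‖ ≤ ε / (2 * ℓ) := by
        filter_upwards [hY] with v hv hvt
        rw [Set.uIoc_of_le ht.1.le] at hvt
        exact hv (hYx.trans hvt.1)
      refine (intervalIntegral.norm_integral_le_of_norm_le_const_ae hb).trans ?_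
      rw [abs_of_nonneg (by linarith [ht.1])]
      calc ε / (2 * ℓ) * (t - x) ≤ ε / (2 * ℓ) * ℓ :=
            mul_le_mul_of_nonneg_left (by linarith [ht.2]) (by positivity)
        _ = ε / 2 := by field_simp
    have h1 := intervalIntegral.norm_integral_le_of_norm_le_const hosc
    rw [intervalIntegral.integral_sub (hRint _ hXx _ (hshift _ hXx)) intervalIntegrable_const,
      intervalIntegral.integral_const, smul_eq_mul, add_sub_cancel_left, abs_of_pos hℓ] at h1
    rw [Real.dist_eq, sub_zero, hMeq x hXx]
    have e : 1 / ℓ * (∫ t in x..x + ℓ, R t) - R x =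
        1 / ℓ * ((∫ t in x..x + ℓ, R t) - ℓ * R x) := by field_simp
    rw [e, abs_mul, abs_of_pos (by positivity : 0 < 1 / ℓ)]
    rw [Real.norm_eq_abs] at h1
    calc 1 / ℓ * |(∫ t in x..x + ℓ, R t) - ℓ * R x| ≤ 1 / ℓ * (ε / 2 * ℓ) :=
          mul_le_mul_of_nonneg_left h1 (by positivity)
      _ = ε / 2 := by field_simp
      _ < ε := by linarith

/-! ### Averaging the Riccati equation -/

theorem eventually_abs_le_of_tendsto_zero {f : ℝ → ℝ} {l : Filter ℝ} (hf : Tendsto f l (𝓝 0))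
    {δ : ℝ} (hδ : 0 < δ) : ∀ᶠ x in l, |f x| ≤ δ := by
  filter_upwards [hf (Metric.closedBall_mem_nhds 0 hδ)] with x hx
  simpa using hx

theorem leftNhdsAE_top_le_atTop : leftNhdsAE ⊤ ≤ atTop := by
  rw [leftNhdsAE, leftNhds_top]
  exact inf_le_left

/-- A vanishing perturbation `D` whose derivative turns the coefficient `Δ` of a Riccati equation
`m' = ρ (Δ + ⋯)` into its moving average, up to an error that vanishes at infinity. -/
theorem exists_corrector {ρ Δ : ℝ → ℝ} {X : ℝ}
    (hint : ∀ x ∈ Set.Ioi X, ∀ y ∈ Set.Ioi X, IntervalIntegrable ρ volume x y)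
    (hpos : ∀ᵐ x, X < x → 0 < ρ x)
    (hosc : ∃ ℓ > 0, ∀ ε > 0, ∃ Y, ∀ᵐ x, Y < x →
      ∫ t in (0 : ℝ)..ℓ, |ρ (x + t) - ρ x| ≤ ε * ρ x)
    (hρ : Tendsto ρ (leftNhdsAE ⊤) (𝓝 0))
    (hΔint : ∀ x ∈ Set.Ioi X, ∀ y ∈ Set.Ioi X, IntervalIntegrable Δ volume x y)
    (hρΔint : ∀ x ∈ Set.Ioi X, ∀ y ∈ Set.Ioi X,
      IntervalIntegrable (fun t => ρ t * Δ t) volume x y)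
    {C : ℝ} (hΔ : ∀ᵐ x, X < x → |Δ x| ≤ C) {ℓ : ℝ} (hℓ : 0 < ℓ) :
    ∃ D γ : ℝ → ℝ, Tendsto D (leftNhdsAE ⊤) (𝓝 0) ∧ Tendsto γ (leftNhdsAE ⊤) (𝓝 0) ∧
      HasACDerivOn D (fun x => ρ x * (1 / ℓ * (∫ t in x..x + ℓ, Δ t) + γ x) - ρ x * Δ x)
        (Set.Ioi X) := by
  have hg : ∀ ε > 0, ∃ Y, ∀ᵐ x, Y < x → |ρ x * Δ x| ≤ ε := by
    intro ε hε
    obtain ⟨Y, hY⟩ := eventually_leftNhdsAE_top.1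
      (eventually_abs_le_of_tendsto_zero hρ (show 0 < ε / (|C| + 1) by positivity))
    refine ⟨max X Y, ?_⟩
    filter_upwards [hY, hΔ] with x h1 h2 hx
    obtain ⟨h3, h4⟩ := max_lt_iff.1 hx
    rw [abs_mul]
    calc |ρ x| * |Δ x| ≤ ε / (|C| + 1) * (|C| + 1) :=
          mul_le_mul (h1 h4) ((h2 h3).trans (by linarith [le_abs_self C])) (abs_nonneg _)
            (by positivity)
      _ = ε := by field_simp
  obtain ⟨D, hD, hD0⟩ := exists_average_corrector hρΔint hg hℓ
  refine ⟨D, fun x => 1 / ℓ * ((∫ t in x..x + ℓ, ρ t * Δ t) - ρ x * ∫ t in x..x + ℓ, Δ t) / ρ x,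
    hD0.mono_left leftNhdsAE_top_le_atTop, ?_, ?_⟩
  · rw [Metric.tendsto_nhds]
    intro ε hε
    obtain ⟨Y, hY⟩ := window_integral_mul_sub_le hint hpos hosc hΔint hρΔint hΔ hℓ
      (show 0 < ε / 2 * ℓ by positivity)
    refine eventually_leftNhdsAE_top.2 ⟨max X Y, ?_⟩
    filter_upwards [hY, hpos] with x h1 h2 hx
    obtain ⟨h3, h4⟩ := max_lt_iff.1 hx
    have hρx := h2 h3
    rw [Real.dist_eq, sub_zero, abs_div, abs_mul, abs_of_pos hρx,
      abs_of_pos (by positivity : 0 < 1 / ℓ), div_lt_iff₀ hρx]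
    calc 1 / ℓ * |(∫ t in x..x + ℓ, ρ t * Δ t) - ρ x * ∫ t in x..x + ℓ, Δ t|
        ≤ 1 / ℓ * (ε / 2 * ℓ * ρ x) := mul_le_mul_of_nonneg_left (h1 h4) (by positivity)
      _ = ε / 2 * ρ x := by field_simp
      _ < ε * ρ x := by nlinarith
  · refine hD.congr_deriv ?_
    filter_upwards [hpos] with x hx hxX
    have := (hx hxX).ne'
    field_simp
    ring

/-- Completing the square in the Riccati equation `m' = ρ (Δ + m - m ^ 2)`: if the averaged
coefficient stays below `-1/4`, then `arctan` of a solution decreases at a rate comparable to `ρ`,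
so no solution exists up to infinity when `ρ` is not integrable. -/
theorem no_global_riccati_solution {ρ Δ A α β γ D L m : ℝ → ℝ} {X ε : ℝ} (hε : 0 < ε)
    (hpos : ∀ᵐ x, X < x → 0 < ρ x)
    (hα : Tendsto α (leftNhdsAE ⊤) (𝓝 0)) (hβ : Tendsto β (leftNhdsAE ⊤) (𝓝 0))
    (hγ : Tendsto γ (leftNhdsAE ⊤) (𝓝 0)) (hD : Tendsto D (leftNhdsAE ⊤) (𝓝 0))
    (hA : ∀ᶠ x in leftNhdsAE ⊤, A x ≤ -(1 / 4) - ε)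
    (hDd : HasACDerivOn D (fun x => ρ x * (A x + γ x) - ρ x * Δ x) (Set.Ioi X))
    (hL : HasACDerivOn L ρ (Set.Ioi X)) (hLt : Tendsto L atTop atTop)
    (hm : HasACDerivOn m
      (fun x => ρ x * (Δ x + (1 + 2 * α x) * m x - (1 - β x) * m x ^ 2)) (Set.Ioi X)) :
    False := by
  have hs : (Set.Ioi X).OrdConnected := Set.ordConnected_Ioi
  set η := min ε 1 with hη
  have hη0 : 0 < η := by positivity
  have hη1 : η ≤ 1 := min_le_right _ _
  have hηε : η ≤ ε := min_le_left _ _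
  have hδ : 0 < η / 8 := by positivity
  obtain ⟨Y, hY⟩ := eventually_leftNhdsAE_top.1
    ((((eventually_abs_le_of_tendsto_zero hα hδ).and (eventually_abs_le_of_tendsto_zero hβ hδ)).and
      ((eventually_abs_le_of_tendsto_zero hγ hδ).and
        (eventually_abs_le_of_tendsto_zero hD hδ))).and hA)
  have hn := ((hm.add hDd).arctan hs).neg.sub (hL.const_mul (η / 8))
  have hmono : ∀ x > max X Y + 1,
      -Real.arctan (m (max X Y + 1) + D (max X Y + 1)) - η / 8 * L (max X Y + 1) ≤
        -Real.arctan (m x + D x) - η / 8 * L x := by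
    intro x hx
    have hX0 : max X Y + 1 ∈ Set.Ioi X := by
      simp only [Set.mem_Ioi]; linarith [le_max_left X Y]
    refine hn.le_of_deriv_nonneg hs hX0 (lt_trans hX0 hx) hx.le ?_
    filter_upwards [hY, hpos] with t h1 h2 ht
    have htX : X < t := lt_trans hX0 ht.1
    obtain ⟨⟨⟨hα, hβ⟩, hγ, hD⟩, hA⟩ := h1 (by linarith [ht.1, le_max_right X Y])
    have hρ := h2 htX
    rw [abs_le] at hα hβ hγ hD
    -- With all errors at most `η / 8`, the averaged right-hand side is at most
    -- `-(m - 1/2) ^ 2 - η + η / 4 * (1 + m ^ 2)`, while `(m - 1/2) ^ 2 + η ≥ η / 2 * (1 + m ^ 2)`.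
    have e1 : 2 * α t * m t ≤ η / 8 * (1 + m t ^ 2) := by
      nlinarith [sq_nonneg (m t - 1), sq_nonneg (m t + 1)]
    have e2 : β t * m t ^ 2 ≤ η / 8 * m t ^ 2 :=
      mul_le_mul_of_nonneg_right hβ.2 (sq_nonneg _)
    have e3 : A t + γ t + (1 + 2 * α t) * m t - (1 - β t) * m t ^ 2 ≤
        -(η / 4) * (1 + m t ^ 2) := by
      have e : η * (m t - 1 / 2) ^ 2 ≤ 1 * (m t - 1 / 2) ^ 2 :=
        mul_le_mul_of_nonneg_right hη1 (sq_nonneg _)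
      nlinarith [mul_nonneg hη0.le (sq_nonneg (m t - 1))]
    have e4 : 1 + (m t + D t) ^ 2 ≤ 2 * (1 + m t ^ 2) := by
      nlinarith [sq_nonneg (m t - D t)]
    have e5 : A t + γ t + (1 + 2 * α t) * m t - (1 - β t) * m t ^ 2 ≤
        -(η / 8) * (1 + (m t + D t) ^ 2) := by nlinarith
    have e6 : 0 < 1 + (m t + D t) ^ 2 := by positivity
    have e7 : 1 / (1 + (m t + D t) ^ 2) *
        (A t + γ t + (1 + 2 * α t) * m t - (1 - β t) * m t ^ 2) ≤ -(η / 8) := by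
      rw [one_div_mul_eq_div, div_le_iff₀ e6]
      exact e5
    have e8 := mul_le_mul_of_nonneg_left e7 hρ.le
    linear_combination e8
  obtain ⟨x, hx1, hx2⟩ := ((eventually_gt_atTop (max X Y + 1)).and
    (((tendsto_const_mul_atTop_of_pos hδ).2 hLt).eventually_gt_atTop
      (η / 8 * L (max X Y + 1) + 2 * Real.pi))).exists
  have h1 := hmono x hx1
  have h2 := Real.neg_pi_div_two_lt_arctan (m x + D x)
  have h3 := Real.arctan_lt_pi_div_two (m (max X Y + 1) + D (max X Y + 1))
  have h4 := Real.pi_pos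
  linarith

/-- A planar linear system with nonnegative coefficients leaves the open positive quadrant
invariant. -/
theorem cooperative_system_pos {y G ρ k₁ k₂ k₃ k₄ : ℝ → ℝ} {X x₀ : ℝ} (hx₀ : X < x₀)
    (hy : HasACDerivOn y (fun x => ρ x * (k₃ x * G x + k₄ x * y x)) (Set.Ioi X))
    (hG : HasACDerivOn G (fun x => ρ x * (k₁ x * G x + k₂ x * y x)) (Set.Ioi X))
    (hk : ∀ᵐ x, x₀ < x → 0 ≤ ρ x ∧ 0 ≤ k₁ x ∧ 0 ≤ k₂ x ∧ 0 ≤ k₃ x ∧ 0 ≤ k₄ x)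
    (hy₀ : 0 < y x₀) (hG₀ : 0 < G x₀) : ∀ x ≥ x₀, 0 < y x := by
  have hs : (Set.Ioi X).OrdConnected := Set.ordConnected_Ioi
  by_contra! h
  obtain ⟨x₁, hx₁, hyx₁⟩ := h
  have hsub : Set.Icc x₀ x₁ ⊆ Set.Ioi X := fun t ht => lt_of_lt_of_le hx₀ ht.1
  have hcont : ContinuousOn (fun t => min (y t) (G t)) (Set.Icc x₀ x₁) :=
    ((hy.continuousOn isOpen_Ioi).mono hsub).inf ((hG.continuousOn isOpen_Ioi).mono hsub)
  have hcomp : IsCompact (Set.Icc x₀ x₁ ∩ (fun t => min (y t) (G t)) ⁻¹' Set.Iic 0) :=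
    isCompact_Icc.of_isClosed_subset (hcont.preimage_isClosed_of_isClosed isClosed_Icc isClosed_Iic)
      Set.inter_subset_left
  -- `t` is the first point at which one of the two components fails to be positive.
  obtain ⟨t, ⟨ht1, ht2⟩, ht3⟩ := hcomp.exists_isLeast
    ⟨x₁, ⟨hx₁, le_rfl⟩, (min_le_left _ _).trans hyx₁⟩
  have hpos : ∀ v ∈ Set.Ioo x₀ t, 0 < y v ∧ 0 < G v := by
    intro v hv
    by_contra hcon
    have : min (y v) (G v) ≤ 0 := by
      by_contra! h
      exact hcon (lt_min_iff.1 h)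
    exact absurd (ht3 ⟨⟨hv.1.le, hv.2.le.trans ht1.2⟩, this⟩) (not_le.2 hv.2)
  have hne : ∀ᵐ v : ℝ, v ≠ t := by simp [ae_iff, measure_singleton]
  have h1 : y x₀ ≤ y t := by
    refine hy.le_of_deriv_nonneg hs hx₀ (hsub ht1) ht1.1 ?_
    filter_upwards [hk, hne] with v hv hvt hvm
    obtain ⟨p1, p2⟩ := hpos v ⟨hvm.1, lt_of_le_of_ne hvm.2 hvt⟩
    obtain ⟨q0, q1, q2, q3, q4⟩ := hv hvm.1
    positivity
  have h2 : G x₀ ≤ G t := by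
    refine hG.le_of_deriv_nonneg hs hx₀ (hsub ht1) ht1.1 ?_
    filter_upwards [hk, hne] with v hv hvt hvm
    obtain ⟨p1, p2⟩ := hpos v ⟨hvm.1, lt_of_le_of_ne hvm.2 hvt⟩
    obtain ⟨q0, q1, q2, q3, q4⟩ := hv hvm.1
    positivity
  have h3 : min (y t) (G t) ≤ 0 := ht2
  exact absurd h3 (not_le.2 (lt_min (hy₀.trans_le h1) (hG₀.trans_le h2)))

/-- If the averaged coefficient stays above `-1/4`, then `z / y = 1/2 - D` is a lower barrier for
the Riccati equation: in the unknowns `y` and `z - (1/2 - D) y` the system is cooperative. -/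
theorem exists_forall_ge_pos {ρ Δ A α β γ D : ℝ → ℝ} {X ε : ℝ} (hε : 0 < ε)
    (hpos : ∀ᵐ x, X < x → 0 < ρ x)
    (hα : Tendsto α (leftNhdsAE ⊤) (𝓝 0)) (hβ : Tendsto β (leftNhdsAE ⊤) (𝓝 0))
    (hγ : Tendsto γ (leftNhdsAE ⊤) (𝓝 0)) (hD : Tendsto D (leftNhdsAE ⊤) (𝓝 0))
    (hA : ∀ᶠ x in leftNhdsAE ⊤, -(1 / 4) + ε ≤ A x)
    (hDd : HasACDerivOn D (fun x => ρ x * (A x + γ x) - ρ x * Δ x) (Set.Ioi X)) :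
    ∃ x₀ > X, ∀ y z : ℝ → ℝ,
      HasACDerivOn y (fun x => ρ x * ((1 - β x) * z x - α x * y x)) (Set.Ioi X) →
      HasACDerivOn z (fun x => ρ x * ((1 + α x) * z x + Δ x * y x)) (Set.Ioi X) →
      y x₀ = 1 → z x₀ = 1 → ∀ x ≥ x₀, 0 < y x := by
  set δ := min (ε / 8) (1 / 16) with hδ
  have hδ0 : 0 < δ := by positivity
  have hδ1 : δ ≤ 1 / 16 := min_le_right _ _
  have hδε : δ ≤ ε / 8 := min_le_left _ _
  obtain ⟨Y, hY⟩ := eventually_leftNhdsAE_top.1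
    ((((eventually_abs_le_of_tendsto_zero hα hδ0).and
      (eventually_abs_le_of_tendsto_zero hβ hδ0)).and
      ((eventually_abs_le_of_tendsto_zero hγ hδ0).and
        (eventually_abs_le_of_tendsto_zero hD hδ0))).and hA)
  obtain ⟨x₀, hx₀, hx₀'⟩ := exists_mem_Ioo_of_mem_ae hY (lt_add_one (max X Y))
  have hXx₀ : X < x₀ := (le_max_left _ _).trans_lt hx₀'.1
  have hYx₀ : Y < x₀ := (le_max_right _ _).trans_lt hx₀'.1
  refine ⟨x₀, hXx₀, fun y z hy hz hy0 hz0 => ?_⟩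
  have hG := hz.sub (((HasACDerivOn.const (1 / 2)).sub hDd).mul hy)
  -- As the errors vanish, `k₁ → 1/2`, `k₂ - A → 1/4`, `k₃ → 1` and `k₄ → 1/2`.
  have hDx₀ := abs_le.1 (hx₀ hYx₀).1.2.2
  refine cooperative_system_pos (ρ := ρ) (G := fun x => z x - (1 / 2 - D x) * y x)
    (k₁ := fun x => 1 + α x - (1 / 2 - D x) * (1 - β x))
    (k₂ := fun x => (1 + α x - (1 / 2 - D x) * (1 - β x)) * (1 / 2 - D x) + (A x + γ x) +
      (1 / 2 - D x) * α x)
    (k₃ := fun x => 1 - β x) (k₄ := fun x => (1 - β x) * (1 / 2 - D x) - α x) hXx₀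
    (hy.congr_deriv (Eventually.of_forall fun x _ => by ring))
    (hG.congr_deriv (Eventually.of_forall fun x _ => by ring)) ?_ (by rw [hy0]; norm_num)
    (by rw [hy0, hz0]; linarith [hDx₀.1])
  filter_upwards [hY, hpos] with x h1 h2 hx
  obtain ⟨⟨⟨hα, hβ⟩, hγ, hD⟩, hA⟩ := h1 (hYx₀.trans hx)
  rw [abs_le] at hα hβ hγ hD
  refine ⟨(h2 (hXx₀.trans hx)).le, ?_, ?_, by linarith, ?_⟩
  · nlinarith
  · have e1 : -(2 * δ) ≤ 2 * (1 / 2 - D x) * α x := by nlinarith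
    have e2 : -δ ≤ (1 / 2 - D x) ^ 2 * β x := by
      have : (1 / 2 - D x) ^ 2 ≤ 1 := by nlinarith
      nlinarith [sq_nonneg (1 / 2 - D x)]
    have e3 : D x ^ 2 ≤ δ := by nlinarith
    linear_combination e1 + e2 + e3 + hA + hγ.1 + 5 * hδε + (3 / 8) * hε.le
  · nlinarith

/-! ### Planar linear systems with locally integrable coefficients -/

theorem intervalIntegrable_of_locallyIntegrable {f : ℝ → ℝ} (hf : LocallyIntegrable f) (x y : ℝ) :
    IntervalIntegrable f volume x y :=
  intervalIntegrable_iff.2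
    ((hf.integrableOn_isCompact isCompact_uIcc).mono_set Set.uIoc_subset_uIcc)

theorem hasACDerivOn_univ_integral {f : ℝ → ℝ} (hf : LocallyIntegrable f) (c : ℝ) :
    HasACDerivOn (fun x => ∫ t in c..x, f t) f Set.univ :=
  HasACDerivOn.integral Set.ordConnected_univ isOpen_univ
    (fun x _ y _ => intervalIntegrable_of_locallyIntegrable hf x y) trivial

theorem locallyIntegrable_abs_add_abs {P Q : ℝ → ℝ} (hP : LocallyIntegrable P)
    (hQ : LocallyIntegrable Q) : LocallyIntegrable fun x => |P x| + |Q x| := by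
  intro x
  obtain ⟨s, hs, h1⟩ := hP x
  obtain ⟨t, ht, h2⟩ := hQ x
  exact ⟨s ∩ t, inter_mem hs ht, (h1.mono_set Set.inter_subset_left).norm.add
    (h2.mono_set Set.inter_subset_right).norm⟩

/-- The exponential weight that makes Volterra operators with kernel bounded by `k` contractive. -/
noncomputable def volterraWeight (k : ℝ → ℝ) (x₀ x : ℝ) : ℝ :=
  Real.exp (2 * |∫ t in x₀..x, k t|)

section Volterra

open scoped BoundedContinuousFunction NNReal

variable {k P : ℝ → ℝ}

theorem volterraWeight_pos (k : ℝ → ℝ) (x₀ x : ℝ) : 0 < volterraWeight k x₀ x := Real.exp_pos _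

theorem continuous_volterraWeight (hk : LocallyIntegrable k) (x₀ : ℝ) : Continuous (volterraWeight k x₀) := by
  have h := ((hasACDerivOn_univ_integral hk x₀).continuousOn isOpen_univ)
  rw [continuousOn_univ] at h
  unfold volterraWeight
  fun_prop

theorem abs_integral_le_volterraWeight (hk : LocallyIntegrable k) (x₀ : ℝ)
    (hP : ∀ x, |P x| ≤ k x) {h : ℝ → ℝ} {C : ℝ}
    (hC : 0 ≤ C) (hh : ∀ x, |h x| ≤ C * volterraWeight k x₀ x) (x : ℝ) :
    |∫ t in x₀..x, P t * h t| ≤ C / 2 * volterraWeight k x₀ x := by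
  have hs : (Set.univ : Set ℝ).OrdConnected := Set.ordConnected_univ
  have hk0 : ∀ x, 0 ≤ k x := fun x => (abs_nonneg _).trans (hP x)
  have hKd := hasACDerivOn_univ_integral hk x₀
  rcases le_total x₀ x with hx | hx
  · have hE := ((hKd.const_mul 2).exp hs).const_mul (C / 2)
    have hint := hE.intervalIntegrable hs (x := x₀) (y := x) trivial trivial
    have hb : ∀ᵐ t, t ∈ Set.Ioc x₀ x → ‖P t * h t‖ ≤
        C / 2 * (Real.exp (2 * ∫ t in x₀..t, k t) * (2 * k t)) := by
      refine Eventually.of_forall fun t ht => ?_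
      have h1 := hh t
      rw [volterraWeight, abs_of_nonneg
        (intervalIntegral.integral_nonneg ht.1.le fun v _ => hk0 v)] at h1
      rw [Real.norm_eq_abs, abs_mul]
      calc |P t| * |h t| ≤ k t * (C * Real.exp (2 * ∫ t in x₀..t, k t)) :=
            mul_le_mul (hP t) h1 (abs_nonneg _) (hk0 t)
        _ = _ := by ring
    have h2 := intervalIntegral.norm_integral_le_of_norm_le hx hb hint
    rw [hE.integral_eq_sub hs trivial trivial, Real.norm_eq_abs] at h2
    rw [volterraWeight, abs_of_nonneg (intervalIntegral.integral_nonneg hx fun v _ => hk0 v)]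
    refine h2.trans (sub_le_self _ (by positivity))
  · have hE := ((hKd.const_mul (-2)).exp hs).const_mul (-(C / 2))
    have hint := hE.intervalIntegrable hs (x := x) (y := x₀) trivial trivial
    have hneg : ∀ t ≤ x₀, |∫ t in x₀..t, k t| = -∫ t in x₀..t, k t := by
      intro t ht
      refine abs_of_nonpos ?_
      rw [intervalIntegral.integral_symm]
      exact neg_nonpos.2 (intervalIntegral.integral_nonneg ht fun v _ => hk0 v)
    have hb : ∀ᵐ t, t ∈ Set.Ioc x x₀ → ‖P t * h t‖ ≤
        -(C / 2) * (Real.exp (-2 * ∫ t in x₀..t, k t) * (-2 * k t)) := by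
      refine Eventually.of_forall fun t ht => ?_
      have h1 := hh t
      rw [volterraWeight, hneg t ht.2, mul_neg, ← neg_mul] at h1
      rw [Real.norm_eq_abs, abs_mul]
      calc |P t| * |h t| ≤ k t * (C * Real.exp (-2 * ∫ t in x₀..t, k t)) :=
            mul_le_mul (hP t) h1 (abs_nonneg _) (hk0 t)
        _ = _ := by ring
    have h2 := intervalIntegral.norm_integral_le_of_norm_le hx hb hint
    rw [hE.integral_eq_sub hs trivial trivial, Real.norm_eq_abs] at h2
    rw [volterraWeight, hneg x hx, intervalIntegral.integral_symm, abs_neg, mul_neg, ← neg_mul]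
    refine h2.trans ?_
    have : 0 ≤ C / 2 * Real.exp (-2 * ∫ t in x₀..x₀, k t) := by positivity
    linarith

/-- The affine Volterra map `h ↦ e⁻¹ (u + ∫ P e h)` with weight `e = volterraWeight k x₀`. -/
noncomputable def volterraMap (hk : LocallyIntegrable k) (hPk : ∀ x, |P x| ≤ k x)
    (hP : LocallyIntegrable P) (x₀ u : ℝ) (h : ℝ →ᵇ ℝ) : ℝ →ᵇ ℝ :=
  BoundedContinuousFunction.ofNormedAddCommGroup
    (fun x => (volterraWeight k x₀ x)⁻¹ *
      (u + ∫ t in x₀..x, P t * (volterraWeight k x₀ t * h t)))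
    (by
      have hw := continuous_volterraWeight hk x₀
      have h1 : LocallyIntegrable fun t => P t * (volterraWeight k x₀ t * h t) :=
        hP.mul_continuous (hw.mul h.continuous)
      have h2 := ((hasACDerivOn_univ_integral h1 x₀).continuousOn isOpen_univ)
      rw [continuousOn_univ] at h2
      exact (hw.inv₀ fun x => (volterraWeight_pos k x₀ x).ne').mul (continuous_const.add h2))
    (|u| + ‖h‖ / 2)
    (by
      intro x
      have hw := volterraWeight_pos k x₀ x
      have hw1 : 1 ≤ volterraWeight k x₀ x := Real.one_le_exp (by positivity)
      have h1 := abs_integral_le_volterraWeight hk x₀ hPk (norm_nonneg h)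
        (h := fun t => volterraWeight k x₀ t * h t) (fun t => by
          rw [abs_mul, abs_of_pos (volterraWeight_pos k x₀ t), mul_comm]
          exact mul_le_mul_of_nonneg_right (h.norm_coe_le_norm t) (volterraWeight_pos k x₀ t).le) x
      rw [Real.norm_eq_abs, abs_mul, abs_inv, abs_of_pos hw, inv_mul_le_iff₀ hw]
      refine (abs_add_le _ _).trans ?_
      nlinarith [abs_nonneg u])

theorem dist_volterraMap_le (hk : LocallyIntegrable k) (x₀ : ℝ) (hPk : ∀ x, |P x| ≤ k x) (hP : LocallyIntegrable P) (u : ℝ)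
    (h₁ h₂ : ℝ →ᵇ ℝ) :
    dist (volterraMap hk hPk hP x₀ u h₁) (volterraMap hk hPk hP x₀ u h₂) ≤ 1 / 2 * dist h₁ h₂ := by
  refine (BoundedContinuousFunction.dist_le (by positivity)).2 fun x => ?_
  have hw := volterraWeight_pos k x₀ x
  have hwc := continuous_volterraWeight hk x₀
  have hint : ∀ h : ℝ →ᵇ ℝ, IntervalIntegrable (fun t => P t * (volterraWeight k x₀ t * h t))
      volume x₀ x := fun h =>
    intervalIntegrable_of_locallyIntegrable (hP.mul_continuous (hwc.mul h.continuous)) _ _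
  have h1 := abs_integral_le_volterraWeight hk x₀ hPk (dist_nonneg (x := h₁) (y := h₂))
    (h := fun t => volterraWeight k x₀ t * h₁ t - volterraWeight k x₀ t * h₂ t) (fun t => by
      rw [← mul_sub, abs_mul, abs_of_pos (volterraWeight_pos k x₀ t), mul_comm]
      exact mul_le_mul_of_nonneg_right (Real.dist_eq (h₁ t) (h₂ t) ▸ BoundedContinuousFunction.dist_coe_le_dist t)
        (volterraWeight_pos k x₀ t).le) x
  simp only [mul_sub] at h1
  rw [intervalIntegral.integral_sub (hint h₁) (hint h₂)] at h1
  simp only [volterraMap, BoundedContinuousFunction.coe_ofNormedAddCommGroup]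
  rw [Real.dist_eq, ← mul_sub, add_sub_add_left_eq_sub, abs_mul, abs_inv, abs_of_pos hw,
    inv_mul_le_iff₀ hw]
  linarith

/-- Existence for the planar system `u' = P w`, `w' = Q u` with locally integrable coefficients:
Banach's fixed point theorem in exponentially weighted spaces over the whole line. -/
theorem exists_linear_system_solution {P Q : ℝ → ℝ} (hP : LocallyIntegrable P)
    (hQ : LocallyIntegrable Q) (x₀ u₁ w₁ : ℝ) :
    ∃ u w : ℝ → ℝ, HasACDerivOn u (fun x => P x * w x) Set.univ ∧
      HasACDerivOn w (fun x => Q x * u x) Set.univ ∧ u x₀ = u₁ ∧ w x₀ = w₁ := by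
  set k : ℝ → ℝ := fun x => |P x| + |Q x| with hk_def
  have hk : LocallyIntegrable k := locallyIntegrable_abs_add_abs hP hQ
  have hPk : ∀ x, |P x| ≤ k x := fun x => le_add_of_nonneg_right (abs_nonneg _)
  have hQk : ∀ x, |Q x| ≤ k x := fun x => le_add_of_nonneg_left (abs_nonneg _)
  let T : (ℝ →ᵇ ℝ) × (ℝ →ᵇ ℝ) → (ℝ →ᵇ ℝ) × (ℝ →ᵇ ℝ) := fun h =>
    (volterraMap hk hPk hP x₀ u₁ h.2, volterraMap hk hQk hQ x₀ w₁ h.1)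
  have hT : ContractingWith (1 / 2 : ℝ≥0) T := by
    refine ⟨by rw [div_lt_one (by norm_num)]; norm_num, LipschitzWith.of_dist_le_mul fun h₁ h₂ => ?_⟩
    have e : ((1 / 2 : ℝ≥0) : ℝ) = 1 / 2 := by simp
    rw [e, Prod.dist_eq, Prod.dist_eq]
    refine max_le ?_ ?_
    · exact (dist_volterraMap_le hk x₀ hPk hP u₁ _ _).trans
        (mul_le_mul_of_nonneg_left (le_max_right _ _) (by norm_num))
    · exact (dist_volterraMap_le hk x₀ hQk hQ w₁ _ _).trans
        (mul_le_mul_of_nonneg_left (le_max_left _ _) (by norm_num))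
  obtain ⟨⟨f, g⟩, hfg⟩ : ∃ h, T h = h := ⟨_, hT.fixedPoint_isFixedPt⟩
  have hw := continuous_volterraWeight hk x₀
  have hf : ∀ x, volterraWeight k x₀ x * f x =
      u₁ + ∫ t in x₀..x, P t * (volterraWeight k x₀ t * g t) := by
    intro x
    have h1 := DFunLike.congr_fun (congrArg Prod.fst hfg) x
    simp only [T, volterraMap, BoundedContinuousFunction.coe_ofNormedAddCommGroup] at h1
    rw [← h1, mul_inv_cancel_left₀ (volterraWeight_pos k x₀ x).ne']
  have hg : ∀ x, volterraWeight k x₀ x * g x =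
      w₁ + ∫ t in x₀..x, Q t * (volterraWeight k x₀ t * f t) := by
    intro x
    have h1 := DFunLike.congr_fun (congrArg Prod.snd hfg) x
    simp only [T, volterraMap, BoundedContinuousFunction.coe_ofNormedAddCommGroup] at h1
    rw [← h1, mul_inv_cancel_left₀ (volterraWeight_pos k x₀ x).ne']
  refine ⟨fun x => volterraWeight k x₀ x * f x, fun x => volterraWeight k x₀ x * g x, ?_, ?_, ?_, ?_⟩
  · rw [funext hf]
    exact ((HasACDerivOn.const u₁).add (hasACDerivOn_univ_integral
      (hP.mul_continuous (hw.mul g.continuous)) x₀)).congr_deriv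
        (Eventually.of_forall fun x _ => by simp)
  · rw [funext hg]
    exact ((HasACDerivOn.const w₁).add (hasACDerivOn_univ_integral
      (hQ.mul_continuous (hw.mul f.continuous)) x₀)).congr_deriv
        (Eventually.of_forall fun x _ => by simp)
  · simp [hf]
  · simp [hg]

end Volterra

/-- A solution of the planar system with zero data at one point vanishes identically, by Gronwall's
inequality for `u ^ 2 + w ^ 2`. -/
theorem linear_system_solution_eq_zero {P Q u w : ℝ → ℝ} (hP : LocallyIntegrable P)
    (hQ : LocallyIntegrable Q) (hu : HasACDerivOn u (fun x => P x * w x) Set.univ)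
    (hw : HasACDerivOn w (fun x => Q x * u x) Set.univ) {x₀ : ℝ} (hu₀ : u x₀ = 0) (hw₀ : w x₀ = 0)
    (x : ℝ) : u x = 0 := by
  have hs : (Set.univ : Set ℝ).OrdConnected := Set.ordConnected_univ
  have hK := hasACDerivOn_univ_integral (locallyIntegrable_abs_add_abs hP hQ) x₀
  have hE := (hu.mul hu).add (hw.mul hw)
  have hb : ∀ t, |2 * (P t + Q t) * (u t * w t)| ≤ (|P t| + |Q t|) * (u t * u t + w t * w t) := by
    intro t
    have h2 : 2 * |u t * w t| ≤ u t * u t + w t * w t := by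
      rw [abs_mul]
      nlinarith [sq_nonneg (|u t| - |w t|), abs_mul_abs_self (u t), abs_mul_abs_self (w t)]
    calc |2 * (P t + Q t) * (u t * w t)| = |P t + Q t| * (2 * |u t * w t|) := by
          rw [abs_mul, abs_mul, abs_two]; ring
      _ ≤ _ := mul_le_mul (abs_add_le _ _) h2 (by positivity) (by positivity)
  have hE0 : u x * u x + w x * w x ≤ 0 := by
    rcases le_total x₀ x with hx | hx
    · have h := (hE.mul ((hK.const_mul (-1)).exp hs)).neg.le_of_deriv_nonneg hs (x := x₀) (y := x)
        trivial trivial hx (Eventually.of_forall fun t _ => by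
          have h1 := (abs_le.1 (hb t)).2
          have h2 := Real.exp_pos (-1 * ∫ v in x₀..t, (|P v| + |Q v|))
          have h3 := mul_nonneg h2.le (sub_nonneg.2 h1)
          linear_combination h3)
      simp only [hu₀, hw₀] at h
      have h2 := Real.exp_pos (-1 * ∫ v in x₀..x, (|P v| + |Q v|))
      by_contra! hcon
      have := mul_pos hcon h2
      linarith
    · have h := (hE.mul (hK.exp hs)).le_of_deriv_nonneg hs (x := x) (y := x₀)
        trivial trivial hx (Eventually.of_forall fun t _ => by
          have h1 := (abs_le.1 (hb t)).1
          have h2 := Real.exp_pos (∫ v in x₀..t, (|P v| + |Q v|))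
          have h3 := mul_nonneg h2.le (sub_nonneg.2 h1)
          linear_combination h3)
      simp only [hu₀, hw₀] at h
      have h2 := Real.exp_pos (∫ v in x₀..x, (|P v| + |Q v|))
      by_contra! hcon
      have := mul_pos hcon h2
      linarith
  nlinarith [mul_self_nonneg (u x), mul_self_nonneg (w x)]

/-- The zeros of a nontrivial solution `u` cannot accumulate: `w` would have to vanish at an
accumulation point, because `u` is strictly monotone where `w` has a constant sign. -/
theorem linear_system_zeros_finite {P Q u w : ℝ → ℝ} {a x₀ : ℝ} (hP : LocallyIntegrable P)
    (hQ : LocallyIntegrable Q) (hu : HasACDerivOn u (fun x => P x * w x) Set.univ)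
    (hw : HasACDerivOn w (fun x => Q x * u x) Set.univ) (hPpos : ∀ᵐ x, a < x → 0 < P x)
    (hne : u x₀ ≠ 0) : {x | x ∈ Set.Icc a x₀ ∧ u x = 0}.Finite := by
  have hs : (Set.univ : Set ℝ).OrdConnected := Set.ordConnected_univ
  have huc : Continuous u := continuousOn_univ.1 (hu.continuousOn isOpen_univ)
  have hwc : Continuous w := continuousOn_univ.1 (hw.continuousOn isOpen_univ)
  by_contra hinf
  obtain ⟨v, hv, hacc⟩ := Set.Infinite.exists_accPt_of_subset_isCompact (K := Set.Icc a x₀) hinf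
    isCompact_Icc fun x hx => hx.1
  have hfreq := accPt_iff_frequently.1 hacc
  have huv : u v = 0 := by
    by_contra h
    have h1 : ∀ᶠ y in 𝓝 v, u y ≠ 0 := huc.continuousAt.eventually_ne h
    obtain ⟨y, hy1, hy2⟩ := (hfreq.and_eventually h1).exists
    exact hy2 hy1.2.2
  by_cases hwv : w v = 0
  · exact hne (linear_system_solution_eq_zero hP hQ hu hw huv hwv x₀)
  -- Multiplying by the constant `w v` makes the sign of `w` near `v` positive.
  have h1 : ∀ᶠ y in 𝓝 v, 0 < w v * w y :=
    (continuousAt_const.mul hwc.continuousAt).eventually_const_lt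
      (show 0 < w v * w v from mul_self_pos.2 hwv)
  obtain ⟨ε, hε, hball⟩ := Metric.eventually_nhds_iff_ball.1 h1
  obtain ⟨y, ⟨hyv, ⟨hya, hyx⟩, huy⟩, hyb⟩ :=
    (hfreq.and_eventually (Metric.ball_mem_nhds v hε)).exists
  have key : ∀ p q, p < q → a ≤ p → p ∈ Metric.ball v ε → q ∈ Metric.ball v ε → u p = 0 →
      u q = 0 → False := by
    intro p q hpq hap hp hq hup huq
    have h2 := (hu.const_mul (w v)).lt_of_deriv_pos hs (x := p) (y := q) trivial trivial hpq (by
      filter_upwards [hPpos] with t ht htm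
      have hb : t ∈ Metric.ball v ε :=
        (convex_ball v ε).ordConnected.out hp hq (Set.Ioc_subset_Icc_self htm)
      have := mul_pos (ht (lt_of_le_of_lt hap htm.1)) (hball t hb)
      linarith [mul_left_comm (w v) (P t) (w t)])
    simp only [hup, huq] at h2
    exact lt_irrefl _ h2
  rcases lt_or_gt_of_ne hyv with h | h
  · exact key y v h hya hyb (Metric.mem_ball_self hε) huy huv
  · exact key v y h hv.1 (Metric.mem_ball_self hε) hyb huv huy

/-! ### Sturm-Liouville equations as first-order systems -/

theorem openIval_top (a : ℝ) : openIval a ⊤ = Set.Ioi a := by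
  ext x
  simp [openIval, EReal.coe_lt_top]

theorem isOpen_openIval (a : ℝ) (b : EReal) : IsOpen (openIval a b) :=
  isOpen_Ioi.inter (isOpen_Iio.preimage continuous_coe_real_ereal)

theorem ordConnected_openIval (a : ℝ) (b : EReal) : (openIval a b).OrdConnected :=
  ⟨fun _ hx _ hy _ hz => ⟨hx.1.trans_le hz.1, lt_of_le_of_lt (EReal.coe_le_coe_iff.2 hz.2) hy.2⟩⟩

theorem openIval_subset {a d : ℝ} (h : a ≤ d) (b : EReal) : openIval d b ⊆ openIval a b :=
  fun _ hx => ⟨h.trans_lt hx.1, hx.2⟩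

theorem ae_restrict_openIval_iff {a : ℝ} {b : EReal} {P : ℝ → Prop} :
    (∀ᵐ x ∂volume.restrict (openIval a b), P x) ↔ ∀ᵐ x, x ∈ openIval a b → P x :=
  ae_restrict_iff' (isOpen_openIval a b).measurableSet

theorem intervalIntegrable_of_locallyIntegrableOn {f : ℝ → ℝ} {s : Set ℝ} (hs : s.OrdConnected)
    (hf : LocallyIntegrableOn f s) {x y : ℝ} (hx : x ∈ s) (hy : y ∈ s) :
    IntervalIntegrable f volume x y :=
  intervalIntegrable_iff.2 ((hf.integrableOn_compact_subset (hs.uIcc_subset hx hy)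
    isCompact_uIcc).mono_set Set.uIoc_subset_uIcc)

/-- A function that is locally integrable on `(a, ∞)` and integrable near `a` becomes locally
integrable on the line when extended by zero. -/
theorem locallyIntegrable_indicator_Ioi {f : ℝ → ℝ} {a d : ℝ} (had : a < d)
    (hf : LocallyIntegrableOn f (Set.Ioi a)) (hfd : IntegrableOn f (Set.Ioo a d)) :
    LocallyIntegrable (Set.indicator (Set.Ioi a) f) := by
  intro x
  refine ⟨Set.Iio (max x d + 1), Iio_mem_nhds (by linarith [le_max_left x d]), ?_⟩
  rw [IntegrableOn, integrable_indicator_iff measurableSet_Ioi, IntegrableOn,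
    Measure.restrict_restrict measurableSet_Ioi]
  have h1 : IntegrableOn f (Set.Icc d (max x d + 1)) :=
    hf.integrableOn_compact_subset (fun t ht => lt_of_lt_of_le had ht.1) isCompact_Icc
  refine (hfd.union h1).mono_set fun t ht => ?_
  rcases lt_or_ge t d with h | h
  · exact Or.inl ⟨ht.1, h⟩
  · exact Or.inr ⟨h, (Set.mem_Iio.1 ht.2).le⟩

theorem intervalIntegrable_of_mul_of_bounded {ρ Δ : ℝ → ℝ} {x y C : ℝ}
    (hρ : IntervalIntegrable ρ volume x y)
    (hρΔ : IntervalIntegrable (fun t => ρ t * Δ t) volume x y)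
    (hpos : ∀ᵐ t, t ∈ Set.uIoc x y → 0 < ρ t) (hΔ : ∀ᵐ t, t ∈ Set.uIoc x y → |Δ t| ≤ C) :
    IntervalIntegrable Δ volume x y := by
  rw [intervalIntegrable_iff] at *
  have hm : AEStronglyMeasurable Δ (volume.restrict (Set.uIoc x y)) := by
    refine (hρΔ.aestronglyMeasurable.aemeasurable.div
      hρ.aestronglyMeasurable.aemeasurable).aestronglyMeasurable.congr ?_
    refine (ae_restrict_iff' measurableSet_uIoc).2 ?_
    filter_upwards [hpos] with t ht htm
    exact mul_div_cancel_left₀ _ (ht htm).ne'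
  have : IsFiniteMeasure (volume.restrict (Set.uIoc x y)) := by rw [Set.uIoc]; infer_instance
  exact Integrable.of_bound hm C ((ae_restrict_iff' measurableSet_uIoc).2 hΔ)

namespace SLExpr

/-- The equation `(τ - lam) u = 0` as a first-order system for `u` and its quasi-derivative. -/
theorem IsSolution.exists_hasACDerivOn {τ : SLExpr} {lam a : ℝ} {b : EReal} {u : ℝ → ℝ}
    (hu : τ.IsSolution lam a b u) (hp : ∀ᵐ x, x ∈ openIval a b → 0 < τ.p x)
    (hr : ∀ᵐ x, x ∈ openIval a b → 0 < τ.r x) :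
    ∃ w : ℝ → ℝ, HasACDerivOn u (fun x => 1 / τ.p x * w x) (openIval a b) ∧
      HasACDerivOn w (fun x => (τ.q x - lam * τ.r x) * u x) (openIval a b) ∧
      ∀ᵐ x, x ∈ openIval a b → w x = τ.p x * deriv u x := by
  obtain ⟨hu, w, hw, hwu, heq⟩ := hu
  rw [ae_restrict_openIval_iff] at hwu heq
  refine ⟨w, .of_locAC hu ?_ (isOpen_openIval a b), .of_locAC hw ?_ (isOpen_openIval a b), hwu⟩
  · filter_upwards [hwu, hp] with x h1 h2 hx
    have := (h2 hx).ne'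
    rw [h1 hx]
    field_simp
  · filter_upwards [heq, hr] with x h1 h2 hx
    have h3 := (h2 hx).ne'
    have h4 := h1 hx
    rw [one_div, inv_mul_eq_iff_eq_mul₀ h3] at h4
    linarith

theorem isSolution_of_hasACDerivOn {τ : SLExpr} {lam a : ℝ} {b : EReal} {u w : ℝ → ℝ}
    (hp : ∀ᵐ x, x ∈ openIval a b → 0 < τ.p x) (hr : ∀ᵐ x, x ∈ openIval a b → 0 < τ.r x)
    (hu : HasACDerivOn u (fun x => 1 / τ.p x * w x) (openIval a b))
    (hw : HasACDerivOn w (fun x => (τ.q x - lam * τ.r x) * u x) (openIval a b)) :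
    τ.IsSolution lam a b u := by
  refine ⟨hu.ac, w, hw.ac, ?_, ?_⟩ <;> rw [ae_restrict_openIval_iff]
  · filter_upwards [hu.hasDerivAt, hp] with x h1 h2 hx
    have := (h2 hx).ne'
    rw [(h1 hx).deriv]
    field_simp
  · filter_upwards [hw.hasDerivAt, hr] with x h1 h2 hx
    have := (h2 hx).ne'
    rw [(h1 hx).deriv]
    field_simp
    ring

/-- Variation of constants around `u₀`: the quotient `u / u₀` and the rescaled Wronskian
`I (u₀ w - w₀ u)` satisfy a linear system with coefficient `Δ`, in which `ρ` plays the role of the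
derivative of the new independent variable `log I`. -/
theorem transformed_system {τ₀ τ₁ : SLExpr} {lam : ℝ} {u₀ w₀ I u w v₀ : ℝ → ℝ} {s : Set ℝ}
    (hs : s.OrdConnected) (hp₀ : ∀ᵐ x, x ∈ s → 0 < τ₀.p x) (hp₁ : ∀ᵐ x, x ∈ s → 0 < τ₁.p x)
    (hu₀ : HasACDerivOn u₀ (fun x => 1 / τ₀.p x * w₀ x) s)
    (hw₀ : HasACDerivOn w₀ (fun x => (τ₀.q x - lam * τ₀.r x) * u₀ x) s)
    (hwu : ∀ᵐ x, x ∈ s → w₀ x = τ₀.p x * deriv u₀ x) (hu₀pos : ∀ x ∈ s, 0 < u₀ x)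
    (hI : HasACDerivOn I (fun x => 1 / (τ₀.p x * u₀ x ^ 2)) s) (hIpos : ∀ x ∈ s, 0 < I x)
    (hv₀ : ∀ x, v₀ x = u₀ x * I x)
    (hu : HasACDerivOn u (fun x => 1 / τ₁.p x * w x) s)
    (hw : HasACDerivOn w (fun x => (τ₁.q x - lam * τ₁.r x) * u x) s) :
    HasACDerivOn (fun x => u x * (u₀ x)⁻¹)
      (fun x => τ₀.rho u₀ v₀ x * ((1 - (τ₁.p x - τ₀.p x) / τ₁.p x) *
        (I x * (u₀ x * w x - w₀ x * u x)) - v₀ x * (τ₀.p x * deriv u₀ x) *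
        ((τ₁.p x - τ₀.p x) / τ₁.p x) * (u x * (u₀ x)⁻¹))) s ∧
    HasACDerivOn (fun x => I x * (u₀ x * w x - w₀ x * u x))
      (fun x => τ₀.rho u₀ v₀ x * ((1 + v₀ x * (τ₀.p x * deriv u₀ x) *
        ((τ₁.p x - τ₀.p x) / τ₁.p x)) * (I x * (u₀ x * w x - w₀ x * u x)) +
        τ₀.Delta τ₁ lam u₀ v₀ x * (u x * (u₀ x)⁻¹))) s := by
  constructor
  · refine (hu.mul (hu₀.inv hs fun x hx => (hu₀pos x hx).ne')).congr_deriv ?_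
    filter_upwards [hp₀, hp₁, hwu] with x h0 h1 h2 hx
    have h0 := (h0 hx).ne'
    have h1 := (h1 hx).ne'
    have h3 := (hu₀pos x hx).ne'
    have h4 := (hIpos x hx).ne'
    rw [← h2 hx, rho, hv₀]
    field_simp
    ring
  · refine (hI.mul ((hu₀.mul hw).sub (hw₀.mul hu))).congr_deriv ?_
    filter_upwards [hp₀, hp₁, hwu] with x h0 h1 h2 hx
    have h0 := (h0 hx).ne'
    have h1 := (h1 hx).ne'
    have h3 := (hu₀pos x hx).ne'
    have h4 := (hIpos x hx).ne'
    rw [Delta, ← h2 hx, rho, hv₀]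
    field_simp
    ring

/-- The Riccati form of the transformed system. -/
theorem riccati_of_system {y z ρ Δ α β : ℝ → ℝ} {s : Set ℝ} (hs : s.OrdConnected)
    (hy : HasACDerivOn y (fun x => ρ x * ((1 - β x) * z x - α x * y x)) s)
    (hz : HasACDerivOn z (fun x => ρ x * ((1 + α x) * z x + Δ x * y x)) s)
    (hne : ∀ x ∈ s, y x ≠ 0) :
    HasACDerivOn (fun x => z x * (y x)⁻¹) (fun x => ρ x * (Δ x + (1 + 2 * α x) * (z x * (y x)⁻¹) -
      (1 - β x) * (z x * (y x)⁻¹) ^ 2)) s := by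
  refine (hz.mul (hy.inv hs hne)).congr_deriv (Eventually.of_forall fun x hx => ?_)
  have := hne x hx
  field_simp
  ring

end SLExpr

/-! ### The minimal solution and d'Alembert's formula -/

theorem leftNhds_neBot {b : EReal} {c : ℝ} (hcb : (c : EReal) < b) : (leftNhds b).NeBot := by
  rw [leftNhds]
  refine comap_neBot fun t ht => ?_
  obtain ⟨l, hl, hlt⟩ := (mem_nhdsLT_iff_exists_Ioo_subset' hcb).1 ht
  obtain ⟨x, h1, h2⟩ := EReal.lt_iff_exists_real_btwn.1 hl
  exact ⟨x, hlt ⟨h1, h2⟩⟩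

theorem eventually_mem_openIval {b : EReal} {c : ℝ} (hcb : (c : EReal) < b) :
    ∀ᶠ x in leftNhds b, x ∈ openIval c b := by
  refine eventually_comap.2 ?_
  filter_upwards [Ioo_mem_nhdsLT hcb] with y hy x hx
  subst hx
  exact ⟨EReal.coe_lt_coe_iff.1 hy.1, hy.2⟩

theorem exists_of_eventually_leftNhdsAE {b : EReal} {c : ℝ} (hcb : (c : EReal) < b) {P : ℝ → Prop}
    (h : ∀ᶠ x in leftNhdsAE b, P x) :
    ∃ e ∈ openIval c b, ∀ᵐ x, x ∈ openIval e b → P x := by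
  obtain ⟨A, hA, B, hB, hAB⟩ := mem_inf_iff_superset.1 h
  obtain ⟨t, ht, htA⟩ := mem_comap.1 hA
  obtain ⟨l, hl, hlt⟩ := (mem_nhdsLT_iff_exists_Ioo_subset' hcb).1 ht
  obtain ⟨e, he1, he2⟩ := EReal.lt_iff_exists_real_btwn.1 (max_lt hl hcb)
  refine ⟨e, ⟨EReal.coe_lt_coe_iff.1 ((le_max_right _ _).trans_lt he1), he2⟩, ?_⟩
  filter_upwards [hB] with x hxB hx
  refine hAB ⟨htA (hlt ⟨(le_max_left l (c : EReal)).trans_lt (he1.trans ?_), hx.2⟩), hxB⟩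
  exact EReal.coe_lt_coe_iff.2 hx.1

namespace SLExpr

variable {τ : SLExpr} {lam a d c : ℝ} {b : EReal} {u₀ : ℝ → ℝ}

theorem IsAdmissible.ae_pos (h : τ.IsAdmissible a b) (had : a ≤ d) :
    (∀ᵐ x, x ∈ openIval d b → 0 < τ.p x) ∧ ∀ᵐ x, x ∈ openIval d b → 0 < τ.r x := by
  constructor
  · filter_upwards [ae_restrict_openIval_iff.1 h.p_pos] with x hx hxd
    exact hx (openIval_subset had b hxd)
  · filter_upwards [ae_restrict_openIval_iff.1 h.r_pos] with x hx hxd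
    exact hx (openIval_subset had b hxd)

theorem IsMinimalPositive.hasACDerivOn_integral (hu₀ : τ.IsMinimalPositive lam d b u₀)
    (h : τ.IsAdmissible a b) (had : a ≤ d) (hc : c ∈ openIval d b) :
    HasACDerivOn (fun x => ∫ t in c..x, 1 / (τ.p t * u₀ t ^ 2))
      (fun x => 1 / (τ.p x * u₀ x ^ 2)) (openIval d b) := by
  have hs := ordConnected_openIval d b
  obtain ⟨hp, hr⟩ := h.ae_pos had
  obtain ⟨w, hu, -, -⟩ := hu₀.sol.exists_hasACDerivOn hp hr
  have hcont := hu.continuousOn (isOpen_openIval d b)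
  refine HasACDerivOn.integral hs (isOpen_openIval d b) (fun x hx y hy => ?_) hc
  have h1 := intervalIntegrable_of_locallyIntegrableOn (ordConnected_openIval a b) h.p_loc
    (openIval_subset had b hx) (openIval_subset had b hy)
  have h2 : ContinuousOn (fun t => (u₀ t ^ 2)⁻¹) (Set.uIcc x y) :=
    ((hcont.mono (hs.uIcc_subset hx hy)).pow 2).inv₀
      fun t ht => (pow_pos (hu₀.pos t (hs.uIcc_subset hx hy ht)) 2).ne'
  refine (h1.mul_continuousOn h2).congr fun t _ => ?_
  simp only [one_div, mul_inv]

theorem IsMinimalPositive.integral_pos (hu₀ : τ.IsMinimalPositive lam d b u₀)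
    (h : τ.IsAdmissible a b) (had : a ≤ d) (hc : c ∈ openIval d b) {x : ℝ}
    (hx : x ∈ openIval c b) : 0 < ∫ t in c..x, 1 / (τ.p t * u₀ t ^ 2) := by
  have hs := ordConnected_openIval d b
  have hx' : x ∈ openIval d b := ⟨hc.1.trans hx.1, hx.2⟩
  have h1 := (hu₀.hasACDerivOn_integral h had hc).lt_of_deriv_pos hs hc hx' hx.1 (by
    filter_upwards [(h.ae_pos had).1] with t ht htm
    have htd : t ∈ openIval d b := hs.out hc hx' (Set.Ioc_subset_Icc_self htm)
    have := ht htd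
    have := hu₀.pos t htd
    positivity)
  simpa using h1

/-- `ρ` is the logarithmic derivative of the integral in d'Alembert's formula. -/
theorem IsMinimalPositive.hasACDerivOn_log (hu₀ : τ.IsMinimalPositive lam d b u₀)
    (h : τ.IsAdmissible a b) (had : a ≤ d) (hc : c ∈ openIval d b) :
    HasACDerivOn (fun x => Real.log (∫ t in c..x, 1 / (τ.p t * u₀ t ^ 2)))
      (τ.rho u₀ (τ.dAlembert u₀ c)) (openIval c b) := by
  refine (((hu₀.hasACDerivOn_integral h had hc).mono (openIval_subset hc.1.le b)).log
    (ordConnected_openIval c b) fun x hx => (hu₀.integral_pos h had hc hx).ne').congr_deriv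
    (Eventually.of_forall fun x _ => ?_)
  rw [rho, dAlembert, one_div, ← mul_inv]
  congr 1
  ring

theorem IsMinimalPositive.rho_pos (hu₀ : τ.IsMinimalPositive lam d b u₀)
    (h : τ.IsAdmissible a b) (had : a ≤ d) (hc : c ∈ openIval d b) :
    ∀ᵐ x, x ∈ openIval c b → 0 < τ.rho u₀ (τ.dAlembert u₀ c) x := by
  filter_upwards [(h.ae_pos had).1] with x hx hxc
  have hxd := openIval_subset hc.1.le b hxc
  have h1 := hx hxd
  have h2 := hu₀.pos x hxd
  have h3 := hu₀.integral_pos h had hc hxc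
  rw [rho, dAlembert]
  positivity

/-- Boundedness of `ρ` near `b` forces `b = ∞`: on a bounded interval a bounded logarithmic
derivative would keep the divergent integral bounded. -/
theorem IsMinimalPositive.eq_top (hu₀ : τ.IsMinimalPositive lam d b u₀)
    (h : τ.IsAdmissible a b) (had : a ≤ d) (hc : c ∈ openIval d b)
    (hρ : ∃ C : ℝ, ∀ᶠ x in leftNhdsAE b, |τ.rho u₀ (τ.dAlembert u₀ c) x| ≤ C) : b = ⊤ := by
  obtain ⟨C, hC⟩ := hρ
  induction b with
  | bot => exact absurd hc.2 (by simp)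
  | top => rfl
  | coe β =>
    exfalso
    have hs := ordConnected_openIval c (β : EReal)
    obtain ⟨e, he, hCe⟩ := exists_of_eventually_leftNhdsAE hc.2 hC
    have hlog := (HasACDerivOn.id.const_mul C).sub (hu₀.hasACDerivOn_log h had hc)
    have hbd : ∀ x ∈ openIval e β, (∫ t in c..x, 1 / (τ.p t * u₀ t ^ 2)) ≤
        Real.exp (Real.log (∫ t in c..e, 1 / (τ.p t * u₀ t ^ 2)) + |C| * (β - e)) := by
      intro x hx
      have hxc : x ∈ openIval c β := ⟨he.1.trans hx.1, hx.2⟩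
      have h1 := hlog.le_of_deriv_nonneg hs he hxc hx.1.le (by
        filter_upwards [hCe] with t ht htm
        have := (le_abs_self _).trans
          (ht ⟨htm.1, (EReal.coe_le_coe_iff.2 htm.2).trans_lt hx.2⟩)
        linarith)
      rw [← Real.log_le_iff_le_exp (hu₀.integral_pos h had hc hxc)]
      have h2 : x < β := EReal.coe_lt_coe_iff.1 hx.2
      have h3 : C * (x - e) ≤ |C| * (β - e) :=
        mul_le_mul (le_abs_self C) (by linarith) (by linarith [hx.1]) (abs_nonneg C)
      linarith
    have := leftNhds_neBot hc.2
    obtain ⟨x, hx1, hx2⟩ := ((eventually_mem_openIval he.2).and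
      ((hu₀.minimal c hc).eventually_gt_atTop _)).exists
    exact absurd (hbd x hx1) (not_le.2 hx2)

/-- Up to null sets, `ρ Δ` is a product of a continuous and a locally integrable function. -/
theorem IsMinimalPositive.intervalIntegrable_rho_mul_Delta {τ₁ : SLExpr}
    (hu₀ : τ.IsMinimalPositive lam d b u₀) (h : τ.IsAdmissible a b) (h₁ : τ₁.IsAdmissible a b)
    (had : a ≤ d) (hc : c ∈ openIval d b) {x y : ℝ} (hx : x ∈ openIval c b)
    (hy : y ∈ openIval c b) :
    IntervalIntegrable (fun t => τ.rho u₀ (τ.dAlembert u₀ c) t *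
      τ.Delta τ₁ lam u₀ (τ.dAlembert u₀ c) t) volume x y := by
  have hs := ordConnected_openIval c b
  have hsa := ordConnected_openIval a b
  obtain ⟨hp, hr⟩ := h.ae_pos had
  obtain ⟨w₀, hu, hw, hwu⟩ := hu₀.sol.exists_hasACDerivOn hp hr
  have hsub : Set.uIcc x y ⊆ openIval c b := hs.uIcc_subset hx hy
  have hsubd := hsub.trans (openIval_subset hc.1.le b)
  have hxa := openIval_subset (had.trans hc.1.le) b hx
  have hya := openIval_subset (had.trans hc.1.le) b hy
  have hcu := (hu.continuousOn (isOpen_openIval d b)).mono hsubd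
  have hcw := (hw.continuousOn (isOpen_openIval d b)).mono hsubd
  have hcI := ((hu₀.hasACDerivOn_integral h had hc).continuousOn (isOpen_openIval d b)).mono hsubd
  have int : ∀ {f : ℝ → ℝ}, LocallyIntegrableOn f (openIval a b) →
      IntervalIntegrable f volume x y := fun hf =>
    intervalIntegrable_of_locallyIntegrableOn hsa hf hxa hya
  have h1 := ((((int h₁.q_loc).sub (int h.q_loc)).sub
    (((int h₁.r_loc).sub (int h.r_loc)).const_mul lam)).continuousOn_mul (hcu.pow 2)).add
    (((int h.p_loc).sub (int h₁.p_loc)).continuousOn_mul (hcw.pow 2))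
  refine (h1.continuousOn_mul hcI).congr_ae ?_
  refine (ae_restrict_iff' measurableSet_uIoc).2 ?_
  filter_upwards [hp, (h₁.ae_pos had).1, hwu] with t h2 h3 h4 htm
  have htc := hsub (Set.uIoc_subset_uIcc htm)
  have htd := openIval_subset hc.1.le b htc
  have e1 := (h2 htd).ne'
  have e2 := (h3 htd).ne'
  have e3 := (hu₀.pos t htd).ne'
  have e4 := (hu₀.integral_pos h had hc htc).ne'
  rw [Delta, ← h4 htd, rho, dAlembert]
  simp only [Pi.pow_apply]
  field_simp

end SLExpr

/-! ### Oscillation and nonoscillation -/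

/-- Prescribed data can be attained at any point. Regularity at `a` allows the coefficients to be
extended by zero beyond `a`, so the zeros of a solution cannot accumulate at `a` either. -/
theorem SLExpr.IsAdmissible.exists_solution {τ : SLExpr} {a : ℝ} (h : τ.IsAdmissible a ⊤)
    (lam x₀ u₁ w₁ : ℝ) : ∃ u w : ℝ → ℝ, τ.IsSolution lam a ⊤ u ∧
      HasACDerivOn u (fun x => 1 / τ.p x * w x) (Set.Ioi a) ∧
      HasACDerivOn w (fun x => (τ.q x - lam * τ.r x) * u x) (Set.Ioi a) ∧
      u x₀ = u₁ ∧ w x₀ = w₁ ∧ (u₁ ≠ 0 → {x | x ∈ Set.Icc a x₀ ∧ u x = 0}.Finite) := by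
  have hp := ae_restrict_openIval_iff.1 h.p_pos
  have hr := ae_restrict_openIval_iff.1 h.r_pos
  have hpl := h.p_loc
  have hql := h.q_loc
  have hrl := h.r_loc
  obtain ⟨d, hd, hpd, hqd, hrd⟩ := h.regular
  rw [openIval_top] at hp hr hpl hql hrl
  have hP := locallyIntegrable_indicator_Ioi hd.1 hpl hpd
  have hQ : LocallyIntegrable (Set.indicator (Set.Ioi a) fun x => τ.q x - lam * τ.r x) :=
    locallyIntegrable_indicator_Ioi hd.1 (fun x hx => (hql x hx).sub ((hrl x hx).smul lam))
      (hqd.sub (hrd.const_mul lam))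
  obtain ⟨u, w, hu, hw, hu₁, hw₁⟩ := exists_linear_system_solution hP hQ x₀ u₁ w₁
  have hu' : HasACDerivOn u (fun x => 1 / τ.p x * w x) (Set.Ioi a) :=
    (hu.mono (Set.subset_univ _)).congr_deriv
      (Eventually.of_forall fun x hx => by rw [Set.indicator_of_mem hx])
  have hw' : HasACDerivOn w (fun x => (τ.q x - lam * τ.r x) * u x) (Set.Ioi a) :=
    (hw.mono (Set.subset_univ _)).congr_deriv
      (Eventually.of_forall fun x hx => by rw [Set.indicator_of_mem hx])
  refine ⟨u, w, ?_, hu', hw', hu₁, hw₁, fun hne => ?_⟩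
  · refine SLExpr.isSolution_of_hasACDerivOn (w := w) ?_ ?_ ?_ ?_ <;> rwa [openIval_top]
  · refine linear_system_zeros_finite hP hQ hu hw ?_ (hu₁ ▸ hne)
    filter_upwards [hp] with x hx hxa
    have : x ∈ Set.Ioi a := hxa
    rw [Set.indicator_of_mem this]
    have := hx this
    positivity

theorem theorem3p8 (a : ℝ) (b : EReal) (hab : (a : EReal) < b)
    (τ₀ τ₁ : SLExpr) (h₀ : τ₀.IsAdmissible a b) (h₁ : τ₁.IsAdmissible a b)
    (lam : ℝ)
    -- a minimal positive solution near `b`, defined and positive on `(d, b)`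
    (d : ℝ) (had : a ≤ d) (u₀ : ℝ → ℝ) (hu₀ : τ₀.IsMinimalPositive lam d b u₀)
    (c : ℝ) (hc : c ∈ openIval d b)
    (v₀ : ℝ → ℝ) (hv₀ : v₀ = τ₀.dAlembert u₀ c)
    (Δ : ℝ → ℝ) (hΔ : Δ = τ₀.Delta τ₁ lam u₀ v₀)
    (ρ : ℝ → ℝ) (hρ : ρ = τ₀.rho u₀ v₀)
    -- the two limit conditions
    (hlim₁ : Tendsto
      (fun x => v₀ x * (τ₀.p x * deriv u₀ x) * ((τ₁.p x - τ₀.p x) / τ₁.p x)) (leftNhdsAE b) (𝓝 0))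
    (hlim₂ : Tendsto (fun x => (τ₁.p x - τ₀.p x) / τ₁.p x) (leftNhdsAE b) (𝓝 0))
    -- `Δ` and `ρ` are bounded near `b`, and `ρ = o(1)`
    (hΔ_bdd : ∃ C : ℝ, ∀ᶠ x in leftNhdsAE b, |Δ x| ≤ C)
    (hρ_bdd : ∃ C : ℝ, ∀ᶠ x in leftNhdsAE b, |ρ x| ≤ C)
    (hρ_zero : Tendsto ρ (leftNhdsAE b) (𝓝 0))
    -- the mean oscillation condition, for some window length
    (hρ_osc : ∃ ℓ : ℝ, 0 < ℓ ∧
      (fun x => 1 / ℓ * ∫ t in (0 : ℝ)..ℓ, |ρ (x + t) - ρ x|) =o[leftNhdsAE b] ρ) :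
    ((⨅ ℓ > (0 : ℝ), limsup (fun x => ((1 / ℓ * ∫ t in x..(x + ℓ), Δ t : ℝ) : EReal)) (leftNhds b))
        < ((-(1 / 4) : ℝ) : EReal) →
      τ₁.IsOscillatory lam a b) ∧
    (((-(1 / 4) : ℝ) : EReal)
        < (⨆ ℓ > (0 : ℝ),
            liminf (fun x => ((1 / ℓ * ∫ t in x..(x + ℓ), Δ t : ℝ) : EReal)) (leftNhds b)) →
      τ₁.IsNonoscillatory lam a b) := by
  subst hv₀
  subst hρ
  obtain rfl : b = ⊤ := hu₀.eq_top h₀ had hc hρ_bdd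
  set v₀ := τ₀.dAlembert u₀ c with hv₀
  set ρ := τ₀.rho u₀ v₀ with hρ
  set I : ℝ → ℝ := fun x => ∫ t in c..x, 1 / (τ₀.p t * u₀ t ^ 2) with hI
  have hdc : d < c := hc.1
  have hac : a < c := had.trans_lt hdc
  have hIpos : ∀ x ∈ Set.Ioi c, 0 < I x := fun x hx =>
    hu₀.integral_pos h₀ had hc (openIval_top c ▸ hx)
  have hId : HasACDerivOn I (fun x => 1 / (τ₀.p x * u₀ x ^ 2)) (Set.Ioi c) :=
    (hu₀.hasACDerivOn_integral h₀ had hc).mono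
      (by rw [openIval_top]; exact Set.Ioi_subset_Ioi hdc.le)
  have hlog : HasACDerivOn (fun x => Real.log (I x)) ρ (Set.Ioi c) :=
    openIval_top c ▸ hu₀.hasACDerivOn_log h₀ had hc
  have hlog_top : Tendsto (fun x => Real.log (I x)) atTop atTop :=
    Real.tendsto_log_atTop.comp (leftNhds_top ▸ hu₀.minimal c hc)
  have hρpos : ∀ᵐ x, c < x → 0 < ρ x := by
    have h := hu₀.rho_pos h₀ had hc
    rwa [openIval_top] at h
  obtain ⟨C, hC⟩ := hΔ_bdd
  obtain ⟨X₁, hX₁⟩ := eventually_leftNhdsAE_top.1 hC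
  obtain ⟨X, hcX, hX₁X⟩ : ∃ X, c ≤ X ∧ X₁ ≤ X := ⟨max c X₁, le_max_left _ _, le_max_right _ _⟩
  have hsX : (Set.Ioi X).OrdConnected := Set.ordConnected_Ioi
  have hXc : Set.Ioi X ⊆ Set.Ioi c := Set.Ioi_subset_Ioi hcX
  have hρpos' : ∀ᵐ x, X < x → 0 < ρ x := hρpos.mono fun x hx h => hx (hcX.trans_lt h)
  have hΔbd : ∀ᵐ x, X < x → |Δ x| ≤ C := hX₁.mono fun x hx h => hx (hX₁X.trans_lt h)
  have hρint : ∀ x ∈ Set.Ioi X, ∀ y ∈ Set.Ioi X, IntervalIntegrable ρ volume x y :=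
    fun x hx y hy => hlog.intervalIntegrable Set.ordConnected_Ioi (hXc hx) (hXc hy)
  have hρΔint : ∀ x ∈ Set.Ioi X, ∀ y ∈ Set.Ioi X,
      IntervalIntegrable (fun t => ρ t * Δ t) volume x y := by
    intro x hx y hy
    rw [hΔ]
    exact hu₀.intervalIntegrable_rho_mul_Delta h₀ h₁ had hc (openIval_top c ▸ hXc hx)
      (openIval_top c ▸ hXc hy)
  have hΔint : ∀ x ∈ Set.Ioi X, ∀ y ∈ Set.Ioi X, IntervalIntegrable Δ volume x y := by
    intro x hx y hy
    have hsub : Set.uIoc x y ⊆ Set.Ioi X := Set.uIoc_subset_uIcc.trans (hsX.uIcc_subset hx hy)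
    exact intervalIntegrable_of_mul_of_bounded (hρint x hx y hy) (hρΔint x hx y hy)
      (hρpos'.mono fun t ht htm => ht (hsub htm)) (hΔbd.mono fun t ht htm => ht (hsub htm))
  have hosc : ∃ ℓ > 0, ∀ ε > 0, ∃ Y, ∀ᵐ x, Y < x →
      ∫ t in (0 : ℝ)..ℓ, |ρ (x + t) - ρ x| ≤ ε * ρ x := by
    obtain ⟨ℓ, hℓ, h⟩ := hρ_osc
    refine ⟨ℓ, hℓ, fun ε hε => ?_⟩
    obtain ⟨Y, hY⟩ := eventually_leftNhdsAE_top.1 (h.def (show 0 < ε / ℓ by positivity))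
    refine ⟨max X Y, ?_⟩
    filter_upwards [hY, hρpos'] with x h1 h2 hx
    obtain ⟨h3, h4⟩ := max_lt_iff.1 hx
    have h5 := (le_abs_self _).trans (h1 h4)
    rw [Real.norm_eq_abs, abs_of_pos (h2 h3), div_mul_eq_mul_div, div_mul_eq_mul_div, one_mul,
      div_le_div_iff_of_pos_right hℓ] at h5
    exact h5
  obtain ⟨hp₀, hr₀⟩ := h₀.ae_pos had
  obtain ⟨w₀, hu₀d, hw₀d, hw₀u⟩ := hu₀.sol.exists_hasACDerivOn hp₀ hr₀
  obtain ⟨hp₁, hr₁⟩ := h₁.ae_pos le_rfl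
  rw [openIval_top] at hp₀ hu₀d hw₀d hw₀u
  have hu₀pos : ∀ x ∈ Set.Ioi d, 0 < u₀ x := fun x hx => hu₀.pos x (openIval_top d ▸ hx)
  have hcd : Set.Ioi c ⊆ Set.Ioi d := Set.Ioi_subset_Ioi hdc.le
  have hca : Set.Ioi c ⊆ Set.Ioi a := Set.Ioi_subset_Ioi hac.le
  have transf : ∀ X' ≥ c, ∀ u w : ℝ → ℝ,
      HasACDerivOn u (fun x => 1 / τ₁.p x * w x) (Set.Ioi a) →
      HasACDerivOn w (fun x => (τ₁.q x - lam * τ₁.r x) * u x) (Set.Ioi a) → _ :=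
    fun X' hX' u w hu hw =>
      have hX'd := (Set.Ioi_subset_Ioi hX').trans hcd
      have hX'a := (Set.Ioi_subset_Ioi hX').trans hca
      SLExpr.transformed_system (v₀ := v₀) (lam := lam) (s := Set.Ioi X') Set.ordConnected_Ioi
      (hp₀.mono fun x hx h => hx (hX'd h))
      (hp₁.mono fun x hx h => hx (openIval_top a ▸ hX'a h))
      (hu₀d.mono hX'd) (hw₀d.mono hX'd) (hw₀u.mono fun x hx h => hx (hX'd h))
      (fun x hx => hu₀pos x (hX'd hx)) (hId.mono (Set.Ioi_subset_Ioi hX'))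
      (fun x hx => hIpos x (Set.Ioi_subset_Ioi hX' hx)) (fun x => rfl) (hu.mono hX'a) (hw.mono hX'a)
  rw [← hρ, ← hΔ] at transf
  rw [leftNhds_top]
  constructor
  · intro hlt
    simp only [iInf_lt_iff] at hlt
    obtain ⟨ℓ, hℓ, hlt⟩ := hlt
    obtain ⟨r, hr1, hr2⟩ := EReal.lt_iff_exists_real_btwn.1 hlt
    have hr2 : r < -(1 / 4) := EReal.coe_lt_coe_iff.1 hr2
    have hA : ∀ᶠ x in leftNhdsAE ⊤,
        1 / ℓ * (∫ t in x..x + ℓ, Δ t) ≤ -(1 / 4) - (-(1 / 4) - r) := by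
      refine Eventually.filter_mono leftNhdsAE_top_le_atTop ?_
      filter_upwards [eventually_lt_of_limsup_lt hr1] with x hx
      have := EReal.coe_lt_coe_iff.1 hx
      linarith
    obtain ⟨D, γ, hD, hγ, hDd⟩ :=
      exists_corrector hρint hρpos' hosc hρ_zero hΔint hρΔint hΔbd hℓ
    rintro ⟨u, hu, -, hfin⟩
    obtain ⟨w, hud, hwd, -⟩ := hu.exists_hasACDerivOn hp₁ hr₁
    rw [openIval_top] at hud hwd hfin
    obtain ⟨M, hM⟩ := hfin.bddAbove
    obtain ⟨X', hXX', hMX'⟩ : ∃ X', X ≤ X' ∧ M ≤ X' := ⟨max X M, le_max_left _ _, le_max_right _ _⟩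
    have hcX' := hcX.trans hXX'
    obtain ⟨hy, hz⟩ := transf X' hcX' u w hud hwd
    have hne : ∀ x ∈ Set.Ioi X', u x * (u₀ x)⁻¹ ≠ 0 := by
      intro x hx
      have hxc : x ∈ Set.Ioi c := lt_of_le_of_lt hcX' hx
      refine mul_ne_zero (fun h0 => ?_) (inv_ne_zero (hu₀pos x (hcd hxc)).ne')
      exact absurd (hM ⟨hca hxc, h0⟩) (not_le.2 (lt_of_le_of_lt hMX' hx))
    exact no_global_riccati_solution (sub_pos.2 hr2)
      (hρpos'.mono fun x hx h => hx (hXX'.trans_lt h)) hlim₁ hlim₂ hγ hD hA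
      (hDd.mono (Set.Ioi_subset_Ioi hXX')) (hlog.mono (Set.Ioi_subset_Ioi hcX')) hlog_top
      (SLExpr.riccati_of_system Set.ordConnected_Ioi hy hz hne)
  · intro hlt
    simp only [lt_iSup_iff] at hlt
    obtain ⟨ℓ, hℓ, hlt⟩ := hlt
    obtain ⟨r, hr1, hr2⟩ := EReal.lt_iff_exists_real_btwn.1 hlt
    have hr1 : -(1 / 4) < r := EReal.coe_lt_coe_iff.1 hr1
    have hA : ∀ᶠ x in leftNhdsAE ⊤,
        -(1 / 4) + (r - -(1 / 4)) ≤ 1 / ℓ * (∫ t in x..x + ℓ, Δ t) := by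
      refine Eventually.filter_mono leftNhdsAE_top_le_atTop ?_
      filter_upwards [eventually_lt_of_lt_liminf hr2] with x hx
      have := EReal.coe_lt_coe_iff.1 hx
      linarith
    obtain ⟨D, γ, hD, hγ, hDd⟩ :=
      exists_corrector hρint hρpos' hosc hρ_zero hΔint hρΔint hΔbd hℓ
    obtain ⟨x₀, hx₀, key⟩ := exists_forall_ge_pos (sub_pos.2 hr1) hρpos' hlim₁ hlim₂ hγ hD hA hDd
    have hx₀c : x₀ ∈ Set.Ioi c := hXc hx₀
    have hu₀x₀ := hu₀pos x₀ (hcd hx₀c)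
    have hIx₀ := hIpos x₀ hx₀c
    -- The data at `x₀` are those for which both transformed unknowns equal one.
    obtain ⟨u, w, hsol, hud, hwd, hux₀, hwx₀, hfin⟩ :=
      h₁.exists_solution lam x₀ (u₀ x₀) (((I x₀)⁻¹ + w₀ x₀ * u₀ x₀) / u₀ x₀)
    obtain ⟨hy, hz⟩ := transf X hcX u w hud hwd
    have hupos : ∀ x ≥ x₀, 0 < u x := by
      intro x hx
      have h := key _ _ hy hz (by rw [hux₀, mul_inv_cancel₀ hu₀x₀.ne'])
        (by rw [hux₀, hwx₀]; field_simp; ring) x hx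
      have hxd := hu₀pos x (hcd (lt_of_lt_of_le hx₀c hx))
      exact (mul_pos_iff_of_pos_right (inv_pos.2 hxd)).1 h
    refine ⟨u, hsol, ⟨x₀, ?_, (hupos x₀ le_rfl).ne'⟩, (hfin hu₀x₀.ne').subset ?_⟩
    · rw [openIval_top]
      exact hca hx₀c
    · rintro x ⟨hx, hux⟩
      rw [openIval_top] at hx
      refine ⟨⟨le_of_lt hx, ?_⟩, hux⟩
      by_contra! hlt
      exact (hupos x hlt.le).ne' hux
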